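/- **Theorem.** Let $\Sigma=\begin{pmatrix}\sigma_{11}&\sigma_{12}\\ \sigma_{12}&\sigma_{22}\end{pmatrix}$ be a real positive definite matrix, and put $$\triangle=\tfrac12\left(\sigma_{11}\partial_u^2+2\sigma_{12}\partial_u\partial_v+\sigma_{22}\partial_v^2\right),\qquad \gamma(x,y)=\tfrac12\left(\sigma_{11}x^2+2\sigma_{12}xy+\sigma_{22}y^2\right),$$ $$\theta=\arccos\left(-\frac{\sigma_{12}}{\sqrt{\sigma_{11}}\sqrt{\sigma_{22}}}\right)\in(0,\pi),\qquad c_\pm=\sqrt{\sigma_{22}/\sigma_{11}}\;e^{\pm i\theta},\qquad \widehat\omega(x)=x^{-\pi/\theta},$$ so that $c_\pm y$ are the zeros of $\gamma(\cdot,y)$. Powers are principal branches; $y$ is a positive real number and $x\in\mathbb C\setminus(-\infty,0]$; a quotient by $\gamma$ is given at the zeros of $\gamma(\cdot,y)$ the value of its limit there. Let $k\ge1$ be an integer. For constants $a_1,a_2,\dots\in\mathbb C$ put $f_n(x)=a_n/x^{k\pi/\theta+2n}$ and define inductively $$L_1(x,y)=\frac{\widehat\omega(x)^k-\widehat\omega(c_+y)^k}{\gamma(x,y)},\qquad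 L_{n+1}(x,y)=\frac{L_n(x,y)-f_n(x)-\left[L_n(c_+y,y)-f_n(c_+y)\right]}{\gamma(x,y)}\quad(n\ge1).$$ Call $f_n$ a decoupling function of $L_n$ if $f_n(c_+y)-f_n(c_-y)=L_n(c_+y,y)-L_n(c_-y,y)$ for all $y>0$. 1. The procedure always works: if $n\ge1$ and $a_1,\dots,a_{n-1}$ are such that $f_j$ is a decoupling function of $L_j$ for all $1\le j<n$, then there is a constant $a_n$ such that $f_n$ is a decoupling function of $L_n$; if $a_1,\dots,a_{n-1}$ are real, $a_n$ can be chosen real. 2. Let $(a_n)_{n\ge1}$ be any sequence for which $f_n$ is a decoupling function of $L_n$ for all $n\ge1$. Then: (a) for all $n\ge1$ and $y>0$, the function $x\mapsto L_n(x,y)$ is holomorphic on $\mathbb C\setminus(-\infty,0]$ (in particular the limits at the zeros of $\gamma$ exist); (b) there are functions $h_n=h_n^k$ ($n\ge0$, $h_0=0$) such that for each $n\ge1$: $h_n$ is complex valued, smooth on $(0,\infty)^2$, continuous on $[0,\infty)^2$ and zero on its boundary; $\triangle^nh_n=0$ and $\triangle h_n=h_{n-1}$ on $(0,\infty)^2$;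 and $L_n$ is the Laplace transform of $h_n$, that is, $L_n(x,y)=\int_0^\infty\!\int_0^\infty e^{-ux-vy}h_n(u,v)\,du\,dv$, absolutely convergent, for $\operatorname{Re}x>0$, $y>0$. If all $a_n$ are real, the $h_n$ are real valued; (c) for each $n\ge1$, with $\alpha=k\pi/\theta+2n$, one has $L_n(x,y)=\dfrac{q_{n,k}(x,y)}{x^\alpha y^\alpha}$ where $q_{n,k}$ is homogeneous of degree $k\pi/\theta+2n$, i.e. $q_{n,k}(tx,ty)=t^{k\pi/\theta+2n}q_{n,k}(x,y)$ for $t>0$, and $\gamma^nq_{n,k}\in\mathbb C[x,y,x^{\pi/\theta},y^{\pi/\theta}]$. If $k\pi/\theta\in\mathbb Z$, in particular if $\pi/\theta\in\mathbb Z$, then $q_{n,k}$ is a homogeneous polynomial in $x,y$ of degree $k\pi/\theta+2n$ with complex coefficients. -/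

import Mathlib

open Set Filter Topology MeasureTheory
open scoped ContDiff

noncomputable section

namespace QuadrantBM

/-- The kernel `γ(x, y) = (σ₁₁ x² + 2 σ₁₂ x y + σ₂₂ y²) / 2` of the Brownian motion with
covariance matrix `S`. -/
def gam (S : Matrix (Fin 2) (Fin 2) ℝ) (x y : ℂ) : ℂ :=
  (1 / 2) * ((S 0 0 : ℂ) * x ^ 2 + 2 * (S 0 1 : ℂ) * x * y + (S 1 1 : ℂ) * y ^ 2)

/-- The angle `θ = arccos (-σ₁₂ / (√σ₁₁ √σ₂₂))`. -/
def theta (S : Matrix (Fin 2) (Fin 2) ℝ) : ℝ :=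
  Real.arccos (-(S 0 1) / (Real.sqrt (S 0 0) * Real.sqrt (S 1 1)))

/-- The exponent `π / θ`. -/
def beta (S : Matrix (Fin 2) (Fin 2) ℝ) : ℝ := Real.pi / theta S

/-- The modulus `c = √(σ₂₂ / σ₁₁)` of the two roots of `γ(·, 1)`. -/
def modulus (S : Matrix (Fin 2) (Fin 2) ℝ) : ℝ := Real.sqrt (S 1 1 / S 0 0)

/-- The root `c₊ = c e^{iθ}` of `γ(·, 1)`. -/
def cPlus (S : Matrix (Fin 2) (Fin 2) ℝ) : ℂ :=
  (modulus S : ℂ) * Complex.exp (Complex.I * (theta S : ℂ))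

/-- The root `c₋ = c e^{-iθ}` of `γ(·, 1)`. -/
def cMinus (S : Matrix (Fin 2) (Fin 2) ℝ) : ℂ :=
  (modulus S : ℂ) * Complex.exp (-(Complex.I * (theta S : ℂ)))

/-- `ω̂(x) = 1 / x^{π/θ}`, with the principal branch of the power. -/
def omegaHat (S : Matrix (Fin 2) (Fin 2) ℝ) (x : ℂ) : ℂ := 1 / x ^ (beta S : ℂ)

/-- The quotient `N / γ`; at a zero of `γ(·, y)` its value is the limit of the quotient
(the removable singularity is filled in). -/
def quotGam (S : Matrix (Fin 2) (Fin 2) ℝ) (N : ℂ → ℝ → ℂ) (x : ℂ) (y : ℝ) : ℂ :=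
  open Classical in
  if gam S x y = 0 then limUnder (𝓝[≠] x) (fun z : ℂ => N z y / gam S z y)
  else N x y / gam S x y

/-- The ansatz `f_n(x) = α / x^{kπ/θ + 2n}` for the `n`-th decoupling function. -/
def ansatz (S : Matrix (Fin 2) (Fin 2) ℝ) (k n : ℕ) (α : ℂ) (x : ℂ) : ℂ :=
  α / x ^ (((k : ℝ) * beta S + 2 * (n : ℝ) : ℝ) : ℂ)

/-- `f` is a decoupling function of `G`:
`f(c₊ y) - f(c₋ y) = G(c₊ y, y) - G(c₋ y, y)` for all `y > 0`. -/
def IsDecoupling (S : Matrix (Fin 2) (Fin 2) ℝ) (f : ℂ → ℂ) (G : ℂ → ℝ → ℂ) : Prop :=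
  ∀ y : ℝ, 0 < y →
    f (cPlus S * y) - f (cMinus S * y) = G (cPlus S * y) y - G (cMinus S * y) y

/-- The functions `L(h_n^k)(x, y)`, built with `f_n(x) = a_n / x^{kπ/θ + 2n}`:
`L(h_1^k) = (ω̂(x)^k - ω̂(c₊ y)^k) / γ(x, y)` and
`L(h_{n+1}^k) = (L(h_n^k)(x, y) - f_n(x) - [L(h_n^k)(c₊ y, y) - f_n(c₊ y)]) / γ(x, y)`.
The index `0` stands for `h_0 = 0`. -/
def Lh (S : Matrix (Fin 2) (Fin 2) ℝ) (k : ℕ) (a : ℕ → ℂ) : ℕ → ℂ → ℝ → ℂ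
  | 0 => fun _ _ => 0
  | 1 => quotGam S (fun x y => omegaHat S x ^ k - omegaHat S (cPlus S * y) ^ k)
  | n + 2 => quotGam S (fun x y =>
      Lh S k a (n + 1) x y - ansatz S k (n + 1) (a (n + 1)) x
        - (Lh S k a (n + 1) (cPlus S * y) y - ansatz S k (n + 1) (a (n + 1)) (cPlus S * y)))

/-- The open quarter plane. -/
def quadrant : Set (ℝ × ℝ) := Ioi 0 ×ˢ Ioi 0

/-- The generator `Δ = (σ₁₁ ∂²/∂u² + 2 σ₁₂ ∂²/∂u∂v + σ₂₂ ∂²/∂v²) / 2` of the Brownian motion. -/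
def lap (S : Matrix (Fin 2) (Fin 2) ℝ) (h : ℝ → ℝ → ℂ) (u v : ℝ) : ℂ :=
  (1 / 2) * ((S 0 0 : ℂ) * deriv (fun s => deriv (fun t => h t v) s) u
    + 2 * (S 0 1 : ℂ) * deriv (fun s => deriv (fun t => h s t) v) u
    + (S 1 1 : ℂ) * deriv (fun s => deriv (fun t => h u t) s) v)

/-- `h` is `n`-polyharmonic in the quarter plane, with Dirichlet boundary conditions. -/
structure IsPolyharmonic (S : Matrix (Fin 2) (Fin 2) ℝ) (n : ℕ) (h : ℝ → ℝ → ℂ) : Prop where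
  smooth : ContDiffOn ℝ ∞ (fun p : ℝ × ℝ => h p.1 p.2) quadrant
  iterate_lap : ∀ p ∈ quadrant, ((lap S)^[n] h) p.1 p.2 = 0
  continuousOn : ContinuousOn (fun p : ℝ × ℝ => h p.1 p.2) (Ici 0 ×ˢ Ici 0)
  zero_left : ∀ v : ℝ, 0 ≤ v → h 0 v = 0
  zero_bottom : ∀ u : ℝ, 0 ≤ u → h u 0 = 0

/-- `G` is the Laplace transform `∫∫ e^{-ux-vy} h(u, v) du dv` of `h`, which converges absolutely
for `Re x > 0` and `y > 0`. -/
def IsLaplaceTransform (h : ℝ → ℝ → ℂ) (G : ℂ → ℝ → ℂ) : Prop :=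
  ∀ (x : ℂ) (y : ℝ), 0 < x.re → 0 < y →
    IntegrableOn (fun p : ℝ × ℝ => Complex.exp (-(p.1 * x) - p.2 * y) * h p.1 p.2) quadrant ∧
    G x y = ∫ p in quadrant, Complex.exp (-(p.1 * x) - p.2 * y) * h p.1 p.2

end QuadrantBM

end

/-! The linear map (u, v) ↦ z = c₊ u + v carries the quarter plane onto the wedge 0 < arg z < θ and
turns Δ into κ ∂_z ∂_z̄. The functions `wedge S j m`, that is Im (z^(jπ/θ + m) z̄^m) = r^(jπ/θ + 2m)
sin (jπφ/θ), vanish on both sides of the wedge when j ≥ 1. Δ kills those with m = 0 and sends index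
m + 1 to a nonzero multiple of index m.

The Laplace transform of a function homogeneous of degree d is a one-dimensional integral against (w
x + y)^(-(d + 2)) (`IsHomogeneousOfDegree.isLaplaceTransform`), and this integral is holomorphic for
x in the whole slit plane. An explicit antiderivative gives `gam_mul_wedgeLaplace_succ`: γ times the
transform for index m + 1 is a multiple of the transform for index m plus a combination of the pure
powers of x and y of the right degree. Hence every wedge sum with transform G has a lift, whose
transform G' satisfies γ G' = G - A x^(-α) - B y^(-α) (`IsWedgeSum.exists_lift`).

At the zeros c± y of γ this identity says that A x^(-α) is a decoupling function of G, and dividing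
it by γ is the recursion for L_(n+1). So by induction every L_n is the transform of a wedge sum. If
a constant a_n ≠ A decouples as well, then c₊^(-α) = c₋^(-α), so α is a multiple of π/θ, and a
harmonic wedge function of the right degree corrects the lift (`exists_isWedgeSum_succ`).

For the form of L_n, clearing denominators in γ L_(n+1) = L_n - A x^(-α) - B y^(-α) gives
polynomials in x, y and their powers with exponent π/θ. When kπ/θ is an integer, the finiteness of
L_(n+1) at the two zeros of γ makes each numerator divisible by γ. -/

namespace QuadrantBM

/-! ### The roots of the kernel -/

section Roots

variable {S : Matrix (Fin 2) (Fin 2) ℝ}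

lemma S00_pos (hS : S.PosDef) : 0 < S 0 0 := hS.diag_pos

lemma S11_pos (hS : S.PosDef) : 0 < S 1 1 := hS.diag_pos

lemma sq_S01_lt (hS : S.PosDef) : S 0 1 ^ 2 < S 0 0 * S 1 1 := by
  have h := hS.det_pos
  have h1 : S 1 0 = S 0 1 := by simpa using hS.isHermitian.apply 0 1
  rw [Matrix.det_fin_two, h1] at h
  nlinarith

lemma modulus_pos (hS : S.PosDef) : 0 < modulus S :=
  Real.sqrt_pos.2 (div_pos (S11_pos hS) (S00_pos hS))

lemma abs_cos_arg_lt_one (hS : S.PosDef) :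
    |-(S 0 1) / (Real.sqrt (S 0 0) * Real.sqrt (S 1 1))| < 1 := by
  have h0 := S00_pos hS
  have h1 := S11_pos hS
  rw [← Real.sqrt_mul h0.le, abs_div, abs_neg, abs_of_nonneg (Real.sqrt_nonneg _),
    div_lt_one (Real.sqrt_pos.2 (mul_pos h0 h1))]
  exact Real.lt_sqrt_of_sq_lt (by rw [sq_abs]; exact sq_S01_lt hS)

lemma theta_pos (hS : S.PosDef) : 0 < theta S :=
  Real.arccos_pos.2 (abs_lt.1 (abs_cos_arg_lt_one hS)).2

lemma theta_lt_pi (hS : S.PosDef) : theta S < Real.pi := by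
  rw [theta, ← Real.arccos_neg_one]
  have h := abs_lt.1 (abs_cos_arg_lt_one hS)
  exact Real.strictAntiOn_arccos (by simp) ⟨h.1.le, h.2.le⟩ h.1

lemma sin_theta_pos (hS : S.PosDef) : 0 < Real.sin (theta S) :=
  Real.sin_pos_of_pos_of_lt_pi (theta_pos hS) (theta_lt_pi hS)

lemma one_lt_beta (hS : S.PosDef) : 1 < beta S :=
  (one_lt_div (theta_pos hS)).2 (theta_lt_pi hS)

lemma beta_mul_theta (hS : S.PosDef) : beta S * theta S = Real.pi :=
  div_mul_cancel₀ _ (theta_pos hS).ne'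

lemma modulus_mul_cos (hS : S.PosDef) :
    S 0 0 * (modulus S * Real.cos (theta S)) = -S 0 1 := by
  have h0 := S00_pos hS
  have h1 := S11_pos hS
  have h := abs_lt.1 (abs_cos_arg_lt_one hS)
  rw [theta, Real.cos_arccos h.1.le h.2.le, modulus, Real.sqrt_div h1.le]
  have e0 := Real.mul_self_sqrt h0.le
  have p0 := Real.sqrt_pos.2 h0
  have p1 := Real.sqrt_pos.2 h1
  field_simp
  rw [sq, e0]

lemma modulus_sq (hS : S.PosDef) : S 0 0 * modulus S ^ 2 = S 1 1 := by
  have h0 := S00_pos hS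
  rw [modulus, Real.sq_sqrt (div_pos (S11_pos hS) h0).le]
  field_simp

/-- The imaginary part of `c₊`. -/
noncomputable def height (S : Matrix (Fin 2) (Fin 2) ℝ) : ℝ := modulus S * Real.sin (theta S)

lemma height_pos (hS : S.PosDef) : 0 < height S := mul_pos (modulus_pos hS) (sin_theta_pos hS)

lemma cPlus_eq : cPlus S = (modulus S * Real.cos (theta S) : ℝ) + (height S : ℝ) * Complex.I := by
  rw [cPlus, mul_comm Complex.I, Complex.exp_mul_I, height]
  push_cast
  ring

lemma cMinus_eq : cMinus S = (modulus S * Real.cos (theta S) : ℝ) - (height S : ℝ) * Complex.I := by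
  rw [cMinus, mul_comm Complex.I, ← neg_mul, Complex.exp_mul_I, height, Complex.cos_neg,
    Complex.sin_neg]
  push_cast
  ring

lemma cPlus_im : (cPlus S).im = height S := by rw [cPlus_eq]; simp

lemma cMinus_im : (cMinus S).im = -height S := by rw [cMinus_eq]; simp

lemma conj_cPlus : (starRingEnd ℂ) (cPlus S) = cMinus S := by
  rw [cPlus_eq, cMinus_eq]
  simp [sub_eq_add_neg, -Complex.ofReal_mul]

lemma cPlus_sub_cMinus : cPlus S - cMinus S = 2 * (height S : ℂ) * Complex.I := by
  rw [cPlus_eq, cMinus_eq]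
  ring

lemma cPlus_ne_cMinus (hS : S.PosDef) : cPlus S ≠ cMinus S := by
  intro h
  have := congrArg Complex.im h
  rw [cPlus_im, cMinus_im] at this
  linarith [height_pos hS]

lemma norm_cPlus (hS : S.PosDef) : ‖cPlus S‖ = modulus S := by
  rw [cPlus, norm_mul, Complex.norm_real, mul_comm Complex.I, Complex.norm_exp_ofReal_mul_I,
    Real.norm_of_nonneg (modulus_pos hS).le, mul_one]

lemma cPlus_add_cMinus (hS : S.PosDef) : (S 0 0 : ℂ) * (cPlus S + cMinus S) = -2 * (S 0 1 : ℂ) := by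
  have h : ((S 0 0 * (modulus S * Real.cos (theta S)) : ℝ) : ℂ) = ((-S 0 1 : ℝ) : ℂ) := by
    rw [modulus_mul_cos hS]
  rw [cPlus_eq, cMinus_eq]
  push_cast at h ⊢
  linear_combination 2 * h

lemma cPlus_mul_cMinus (hS : S.PosDef) : (S 0 0 : ℂ) * (cPlus S * cMinus S) = (S 1 1 : ℂ) := by
  rw [← conj_cPlus, Complex.mul_conj, Complex.normSq_eq_norm_sq, norm_cPlus hS]
  exact_mod_cast congrArg (fun r : ℝ => (r : ℂ)) (modulus_sq hS)

lemma gam_eq (hS : S.PosDef) (x y : ℂ) :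
    gam S x y = (S 0 0 : ℂ) / 2 * ((x - cPlus S * y) * (x - cMinus S * y)) := by
  rw [gam]
  linear_combination (-1 / 2 * y ^ 2) * cPlus_mul_cMinus hS + (1 / 2 * x * y) * cPlus_add_cMinus hS

lemma gam_eq_zero_iff (hS : S.PosDef) (x y : ℂ) :
    gam S x y = 0 ↔ x = cPlus S * y ∨ x = cMinus S * y := by
  have h : (S 0 0 : ℂ) / 2 ≠ 0 := by
    have := (S00_pos hS).ne'
    simpa using this
  rw [gam_eq hS, mul_eq_zero, mul_eq_zero, sub_eq_zero, sub_eq_zero]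
  simp [h]

lemma cPlus_mul_mem (hS : S.PosDef) {y : ℝ} (hy : 0 < y) : cPlus S * y ∈ Complex.slitPlane := by
  right
  rw [Complex.im_mul_ofReal, cPlus_im]
  exact (mul_pos (height_pos hS) hy).ne'

lemma cMinus_mul_mem (hS : S.PosDef) {y : ℝ} (hy : 0 < y) : cMinus S * y ∈ Complex.slitPlane := by
  right
  rw [Complex.im_mul_ofReal, cMinus_im, neg_mul]
  exact (neg_neg_of_pos (mul_pos (height_pos hS) hy)).ne

lemma cPlus_ne_zero (hS : S.PosDef) : cPlus S ≠ 0 := by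
  rw [← norm_pos_iff, norm_cPlus hS]; exact modulus_pos hS

/-- Powers of the roots. -/
lemma cPlus_cpow (hS : S.PosDef) (s : ℝ) :
    cPlus S ^ (s : ℂ) = ((modulus S ^ s : ℝ) : ℂ) * Complex.exp ((theta S * s : ℝ) * Complex.I) := by
  have hc := modulus_pos hS
  have hlog : Complex.log (cPlus S) = (Real.log (modulus S) : ℝ) + theta S * Complex.I := by
    rw [cPlus, Complex.log_ofReal_mul hc (Complex.exp_ne_zero _), mul_comm Complex.I,
      Complex.log_exp]
    · simpa using (by linarith [theta_pos hS, Real.pi_pos] : -Real.pi < theta S)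
    · simpa using (theta_lt_pi hS).le
  rw [Complex.cpow_def_of_ne_zero (cPlus_ne_zero hS), hlog, Real.rpow_def_of_pos hc,
    Complex.ofReal_exp, ← Complex.exp_add]
  congr 1
  push_cast
  ring

lemma cMinus_cpow (hS : S.PosDef) (s : ℝ) :
    cMinus S ^ (s : ℂ)
      = ((modulus S ^ s : ℝ) : ℂ) * Complex.exp (-((theta S * s : ℝ) * Complex.I)) := by
  have hne : (cPlus S).arg ≠ Real.pi := by
    have := cPlus_mul_mem hS one_pos
    rw [Complex.ofReal_one, mul_one, Complex.mem_slitPlane_iff_arg] at this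
    exact this.1
  have h := Complex.cpow_conj (cPlus S) s hne
  rw [Complex.conj_ofReal, conj_cPlus] at h
  rw [← Complex.conj_conj (cMinus S ^ (s : ℂ)), ← h, cPlus_cpow hS, map_mul, Complex.conj_ofReal,
    ← Complex.exp_conj, map_mul, Complex.conj_ofReal, Complex.conj_I, mul_neg]

lemma exp_natCast_pi (j : ℕ) : Complex.exp ((j * Real.pi : ℝ) * Complex.I) = (-1) ^ j := by
  rw [← Complex.exp_pi_mul_I, ← Complex.exp_nat_mul]
  push_cast
  ring_nf

lemma exp_neg_natCast_pi (j : ℕ) : Complex.exp (-((j * Real.pi : ℝ) * Complex.I)) = (-1) ^ j := by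
  rw [Complex.exp_neg, exp_natCast_pi, ← inv_pow]
  norm_num

lemma exp_neg_natCast_pi' (j : ℕ) : Complex.exp ((-(j * Real.pi) : ℝ) * Complex.I) = (-1) ^ j := by
  rw [← exp_neg_natCast_pi]
  push_cast
  ring_nf

/-- A positive real factor does not change the argument, so no branch correction appears. -/
lemma cpow_mul_ofReal {x : ℂ} {y : ℝ} (hx : x ≠ 0) (hy : 0 < y) (s : ℂ) :
    (x * y) ^ s = x ^ s * (y : ℂ) ^ s := by
  rw [mul_comm x, Complex.cpow_def_of_ne_zero (mul_ne_zero (by exact_mod_cast hy.ne') hx),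
    Complex.log_ofReal_mul hy hx, Complex.cpow_def_of_ne_zero hx,
    Complex.cpow_def_of_ne_zero (by exact_mod_cast hy.ne'), Complex.ofReal_log hy.le, add_mul,
    Complex.exp_add, mul_comm]

end Roots

/-! ### The Gamma integral with a complex parameter -/

lemma integrableOn_rpow_mul_exp {a b : ℝ} (ha : -1 < a) (hb : 0 < b) :
    IntegrableOn (fun t : ℝ => t ^ a * Real.exp (-(b * t))) (Ioi 0) := by
  have := integrableOn_rpow_mul_exp_neg_mul_rpow ha (p := 1) one_pos hb
  simpa using this

lemma norm_ofReal_rpow_mul_exp {t : ℝ} (ht : 0 < t) (a : ℝ) (r : ℂ) :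
    ‖((t ^ a : ℝ) : ℂ) * Complex.exp (-(r * t))‖ = t ^ a * Real.exp (-(r.re * t)) := by
  rw [norm_mul, Complex.norm_real, Real.norm_of_nonneg (Real.rpow_nonneg ht.le _),
    Complex.norm_exp]
  simp

lemma aestronglyMeasurable_rpow_mul_exp (a : ℝ) (r : ℂ) :
    AEStronglyMeasurable (fun t : ℝ => ((t ^ a : ℝ) : ℂ) * Complex.exp (-(r * t)))
      (volume.restrict (Ioi 0)) := by
  apply Measurable.aestronglyMeasurable
  fun_prop

lemma integrableOn_ofReal_rpow_mul_exp {a : ℝ} (ha : -1 < a) {r : ℂ} (hr : 0 < r.re) :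
    IntegrableOn (fun t : ℝ => ((t ^ a : ℝ) : ℂ) * Complex.exp (-(r * t))) (Ioi 0) := by
  refine (integrableOn_rpow_mul_exp ha hr).mono' (aestronglyMeasurable_rpow_mul_exp a r) ?_
  filter_upwards [ae_restrict_mem measurableSet_Ioi] with t ht
  exact (norm_ofReal_rpow_mul_exp ht a r).le

lemma differentiableOn_gammaIntegral {a : ℝ} (ha : -1 < a) :
    DifferentiableOn ℂ
      (fun r : ℂ => ∫ t in Ioi (0 : ℝ), ((t ^ a : ℝ) : ℂ) * Complex.exp (-(r * t)))
      {r : ℂ | 0 < r.re} := by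
  intro r₀ hr₀
  have hr₀' : 0 < r₀.re := hr₀
  have hs : {r : ℂ | r₀.re / 2 < r.re} ∈ 𝓝 r₀ :=
    (isOpen_lt continuous_const Complex.continuous_re).mem_nhds (by simp; linarith)
  refine (hasDerivAt_integral_of_dominated_loc_of_deriv_le
    (F' := fun r (t : ℝ) => -(((t ^ (a + 1) : ℝ) : ℂ) * Complex.exp (-(r * t))))
    (bound := fun t => t ^ (a + 1) * Real.exp (-(r₀.re / 2 * t)))
    hs (Eventually.of_forall fun r => aestronglyMeasurable_rpow_mul_exp a r)
    (integrableOn_ofReal_rpow_mul_exp ha hr₀) (aestronglyMeasurable_rpow_mul_exp (a + 1) r₀).neg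
    ?_ (integrableOn_rpow_mul_exp (by linarith) (by linarith)) ?_).2.differentiableAt.differentiableWithinAt
  · filter_upwards [ae_restrict_mem measurableSet_Ioi] with t ht r hr
    have ht' : 0 < t := ht
    rw [norm_neg, norm_ofReal_rpow_mul_exp ht]
    have : r₀.re / 2 * t ≤ r.re * t := mul_le_mul_of_nonneg_right (le_of_lt hr) ht'.le
    gcongr
  · filter_upwards [ae_restrict_mem measurableSet_Ioi] with t ht r hr
    have ht' : 0 < t := ht
    have h1 : HasDerivAt (fun r : ℂ => -(r * t)) (-(1 * (t : ℂ))) r :=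
      ((hasDerivAt_id r).mul_const _).neg
    have h2 := h1.cexp.const_mul (((t ^ a : ℝ) : ℂ))
    refine h2.congr_deriv ?_
    rw [Real.rpow_add_one ht'.ne']
    push_cast
    ring

/-- For real r this is the Gamma integral. Both sides are holomorphic in the right half plane and
agree at the real points accumulating at 1, so the identity theorem applies. -/
lemma integral_rpow_mul_cexp {a : ℝ} (ha : 0 < a) {r : ℂ} (hr : 0 < r.re) :
    ∫ t in Ioi (0 : ℝ), ((t ^ (a - 1) : ℝ) : ℂ) * Complex.exp (-(r * t))
      = Real.Gamma a * r ^ (-(a : ℂ)) := by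
  have hopen : IsOpen {r : ℂ | 0 < r.re} := isOpen_lt continuous_const Complex.continuous_re
  have h1 : AnalyticOnNhd ℂ
      (fun r : ℂ => ∫ t in Ioi (0 : ℝ), ((t ^ (a - 1) : ℝ) : ℂ) * Complex.exp (-(r * t)))
      {r : ℂ | 0 < r.re} :=
    (differentiableOn_gammaIntegral (by linarith)).analyticOnNhd hopen
  have h2 : AnalyticOnNhd ℂ (fun r : ℂ => (Real.Gamma a : ℂ) * r ^ (-(a : ℂ)))
      {r : ℂ | 0 < r.re} := by
    refine DifferentiableOn.analyticOnNhd (fun z hz => ?_) hopen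
    exact (((hasDerivAt_id z).cpow_const (Or.inl hz)).const_mul _).differentiableAt.differentiableWithinAt
  have hreal : ∀ s : ℝ, 0 < s →
      ∫ t in Ioi (0 : ℝ), ((t ^ (a - 1) : ℝ) : ℂ) * Complex.exp (-((s : ℂ) * t))
        = Real.Gamma a * (s : ℂ) ^ (-(a : ℂ)) := by
    intro s hs
    have h := Complex.integral_cpow_mul_exp_neg_mul_Ioi (a := (a : ℂ)) (r := s) (by simpa) hs
    rw [Complex.Gamma_ofReal, one_div, Complex.inv_cpow _ _ (by
      rw [Complex.arg_ofReal_of_nonneg hs.le]; exact Real.pi_pos.ne), ← Complex.cpow_neg] at h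
    rw [mul_comm, ← h]
    refine setIntegral_congr_fun measurableSet_Ioi fun t ht => ?_
    have ht' : 0 < t := ht
    simp only [Complex.ofReal_cpow ht'.le]
    push_cast
    rfl
  have hfreq : ∃ᶠ z in 𝓝[≠] (1 : ℂ),
      (∫ t in Ioi (0 : ℝ), ((t ^ (a - 1) : ℝ) : ℂ) * Complex.exp (-(z * t)))
        = (Real.Gamma a : ℂ) * z ^ (-(a : ℂ)) := by
    have htend : Tendsto (fun s : ℝ => (s : ℂ)) (𝓝[>] 1) (𝓝[≠] (1 : ℂ)) := by
      refine tendsto_nhdsWithin_iff.2 ⟨?_, ?_⟩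
      · have := Complex.continuous_ofReal.tendsto 1
        rw [Complex.ofReal_one] at this
        exact this.mono_left nhdsWithin_le_nhds
      · filter_upwards [self_mem_nhdsWithin] with s hs
        have : (1 : ℝ) < s := hs
        simpa using this.ne'
    refine htend.frequently (Eventually.frequently ?_)
    filter_upwards [self_mem_nhdsWithin] with s hs
    exact hreal s (lt_trans one_pos hs)
  exact h1.eqOn_of_preconnected_of_frequently_eq h2
    (convex_halfSpace_re_gt 0).isPreconnected (by simp) hfreq hr

/-! ### The one-dimensional form of the Laplace transform of a homogeneous function -/

lemma mul_add_mem_slitPlane {x : ℂ} (hx : x ∈ Complex.slitPlane) {y : ℝ} (hy : 0 < y) {w : ℝ}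
    (hw : 0 ≤ w) : (w : ℂ) * x + y ∈ Complex.slitPlane := by
  rcases hw.eq_or_lt with rfl | hw
  · simpa using hy
  · rcases hx with h | h
    · left
      simp only [Complex.add_re, Complex.re_ofReal_mul, Complex.ofReal_re]
      positivity
    · right
      simp only [Complex.add_im, Complex.im_ofReal_mul, Complex.ofReal_im, add_zero]
      exact mul_ne_zero hw.ne' h

/-- Divided by 1 + w, the point w x + y lies on the segment from y to x. This segment is compact and
avoids 0 because x is in the slit plane. -/
lemma exists_mul_one_add_le_norm {x : ℂ} (hx : x ∈ Complex.slitPlane) {y : ℝ} (hy : 0 < y) :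
    ∃ c : ℝ, 0 < c ∧ ∀ w : ℝ, 0 ≤ w → c * (1 + w) ≤ ‖(w : ℂ) * x + y‖ := by
  obtain ⟨s₀, hs₀, hmin⟩ := isCompact_Icc.exists_isMinOn (nonempty_Icc.2 (zero_le_one (α := ℝ)))
    (f := fun s : ℝ => ‖(s : ℂ) * x + ((1 - s) * y : ℝ)‖) (by fun_prop)
  have hne : ∀ s ∈ Icc (0 : ℝ) 1, (s : ℂ) * x + ((1 - s) * y : ℝ) ≠ 0 := by
    intro s hs
    rcases hs.2.eq_or_lt with rfl | h1
    · simpa using Complex.slitPlane_ne_zero hx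
    · exact Complex.slitPlane_ne_zero
        (mul_add_mem_slitPlane hx (mul_pos (sub_pos.2 h1) hy) hs.1)
  refine ⟨_, norm_pos_iff.2 (hne s₀ hs₀), fun w hw => ?_⟩
  have h1 : 0 < 1 + w := by linarith
  have hs : w / (1 + w) ∈ Icc (0 : ℝ) 1 := ⟨by positivity, (div_le_one h1).2 (by linarith)⟩
  have h2 : (w : ℂ) * x + y
      = ((1 + w : ℝ) : ℂ) * (((w / (1 + w) : ℝ) : ℂ) * x + ((1 - w / (1 + w)) * y : ℝ)) := by
    have h3 : (1 + w : ℂ) ≠ 0 := by exact_mod_cast h1.ne'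
    push_cast
    field_simp
    ring
  rw [h2, norm_mul, Complex.norm_real, Real.norm_of_nonneg h1.le, mul_comm]
  exact mul_le_mul_of_nonneg_left (hmin hs) h1.le

/-- `H` is continuous on `(0, ∞)` and grows at most like `(1 + w)^d`. -/
structure HasGrowth (d : ℝ) (H : ℝ → ℂ) : Prop where
  continuousOn : ContinuousOn H (Ioi 0)
  bound : ∃ C : ℝ, 0 ≤ C ∧ ∀ w : ℝ, 0 < w → ‖H w‖ ≤ C * (1 + w) ^ d

lemma integrableOn_one_add_rpow_neg_two :
    IntegrableOn (fun w : ℝ => (1 + w) ^ (-2 : ℝ)) (Ioi 0) := by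
  have := integrableOn_add_rpow_Ioi_of_lt (a := -2) (c := 0) (m := 1) (by norm_num) (by norm_num)
  simpa [add_comm] using this

lemma HasGrowth.continuousOn_kernel {d : ℝ} {H : ℝ → ℂ} (hH : HasGrowth d H) {x : ℂ}
    (hx : x ∈ Complex.slitPlane) {y : ℝ} (hy : 0 < y) (s : ℂ) :
    ContinuousOn (fun w : ℝ => H w * ((w : ℂ) * x + y) ^ s) (Ioi 0) := by
  refine hH.continuousOn.mul (ContinuousOn.cpow (by fun_prop) continuousOn_const fun w hw => ?_)
  exact mul_add_mem_slitPlane hx hy (le_of_lt hw)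

/-- Growth of order d against decay of order d + 2 leaves (1 + w)^(-2), which is integrable. -/
lemma HasGrowth.norm_kernel_le {d : ℝ} (hd : 0 ≤ d + 2) {H : ℝ → ℂ} {C : ℝ} {w : ℝ} (hw : 0 < w)
    (hb : ‖H w‖ ≤ C * (1 + w) ^ d) {c : ℝ} (hc : 0 < c) {z : ℂ} (hz : c * (1 + w) ≤ ‖z‖) :
    ‖H w * z ^ (-(d + 2 : ℝ) : ℂ)‖ ≤ C * c ^ (-(d + 2)) * (1 + w) ^ (-2 : ℝ) := by
  have h1 : 0 < 1 + w := by linarith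
  rw [norm_mul, ← Complex.ofReal_neg, Complex.norm_cpow_real]
  calc ‖H w‖ * ‖z‖ ^ (-(d + 2)) ≤ (C * (1 + w) ^ d) * (c * (1 + w)) ^ (-(d + 2)) := by
        refine mul_le_mul hb ?_ (by positivity) ((norm_nonneg _).trans hb)
        exact Real.rpow_le_rpow_of_nonpos (by positivity) hz (by linarith)
    _ = C * c ^ (-(d + 2)) * (1 + w) ^ (-2 : ℝ) := by
        rw [Real.mul_rpow hc.le h1.le]
        have : (1 + w) ^ (-2 : ℝ) = (1 + w) ^ d * (1 + w) ^ (-(d + 2)) := by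
          rw [← Real.rpow_add h1]; ring_nf
        rw [this]; ring

lemma HasGrowth.integrableOn_kernel {d : ℝ} (hd : 0 ≤ d + 2) {H : ℝ → ℂ} (hH : HasGrowth d H)
    {x : ℂ} (hx : x ∈ Complex.slitPlane) {y : ℝ} (hy : 0 < y) :
    IntegrableOn (fun w : ℝ => H w * ((w : ℂ) * x + y) ^ (-(d + 2 : ℝ) : ℂ)) (Ioi 0) := by
  obtain ⟨C, -, hC⟩ := hH.bound
  obtain ⟨c, hc, hcw⟩ := exists_mul_one_add_le_norm hx hy
  refine (integrableOn_one_add_rpow_neg_two.const_mul (C * c ^ (-(d + 2)))).mono'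
    ((hH.continuousOn_kernel hx hy _).aestronglyMeasurable measurableSet_Ioi) ?_
  filter_upwards [ae_restrict_mem measurableSet_Ioi] with w hw
  exact HasGrowth.norm_kernel_le hd hw (hC w hw) hc (hcw w (le_of_lt hw))

/-- The Laplace transform of the function `h(u, v) = v^d H(u / v)`, as an integral along the
line `v = 1`. -/
noncomputable def lineLaplace (d : ℝ) (H : ℝ → ℂ) (x : ℂ) (y : ℝ) : ℂ :=
  (Real.Gamma (d + 2) : ℂ) * ∫ w in Ioi (0 : ℝ), H w * ((w : ℂ) * x + y) ^ (-(d + 2 : ℝ) : ℂ)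

/-- Differentiation under the integral. The lower bound c (1 + w) at x₀ survives as (c / 2)(1 + w)
on the ball of radius c / 2. The factor w produced by the derivative is absorbed by w / |w x + y| ≤
2 / c. -/
lemma HasGrowth.differentiableOn_lineLaplace {d : ℝ} (hd : 0 ≤ d + 2) {H : ℝ → ℂ}
    (hH : HasGrowth d H) {y : ℝ} (hy : 0 < y) :
    DifferentiableOn ℂ (fun x => lineLaplace d H x y) Complex.slitPlane := by
  intro x₀ hx₀
  obtain ⟨C, hC0, hC⟩ := hH.bound
  obtain ⟨c, hc, hcw⟩ := exists_mul_one_add_le_norm hx₀ hy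
  have hs : Complex.slitPlane ∩ Metric.ball x₀ (c / 2) ∈ 𝓝 x₀ :=
    inter_mem (Complex.isOpen_slitPlane.mem_nhds hx₀) (Metric.ball_mem_nhds _ (by linarith))
  have hlow : ∀ x ∈ Metric.ball x₀ (c / 2), ∀ w : ℝ, 0 < w →
      c / 2 * (1 + w) ≤ ‖(w : ℂ) * x + y‖ := by
    intro x hx w hw
    have h1 : ‖(w : ℂ) * x₀ + y‖ ≤ ‖(w : ℂ) * x + y‖ + w * ‖x₀ - x‖ := by
      have : (w : ℂ) * x₀ + y = ((w : ℂ) * x + y) + w * (x₀ - x) := by ring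
      rw [this]
      refine (norm_add_le _ _).trans ?_
      rw [norm_mul, Complex.norm_real, Real.norm_of_nonneg hw.le]
    have h2 : ‖x₀ - x‖ ≤ c / 2 := by
      rw [← dist_eq_norm, dist_comm]; exact (Metric.mem_ball.1 hx).le
    have h3 := hcw w hw.le
    nlinarith [mul_le_mul_of_nonneg_left h2 hw.le]
  refine DifferentiableAt.differentiableWithinAt (DifferentiableAt.const_mul ?_ _)
  refine (hasDerivAt_integral_of_dominated_loc_of_deriv_le
    (F := fun x (w : ℝ) => H w * ((w : ℂ) * x + y) ^ (-(d + 2 : ℝ) : ℂ))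
    (μ := volume.restrict (Ioi 0)) (F' := fun x (w : ℝ) => (-(d + 2 : ℝ) : ℂ) * w * ((w : ℂ) * x + y)⁻¹ *
      (H w * ((w : ℂ) * x + y) ^ (-(d + 2 : ℝ) : ℂ)))
    (bound := fun w => (d + 2) * (c / 2)⁻¹ * (C * (c / 2) ^ (-(d + 2)) * (1 + w) ^ (-2 : ℝ)))
    hs ?_ (hH.integrableOn_kernel hd hx₀ hy) ?_ ?_
    ((integrableOn_one_add_rpow_neg_two.const_mul _).const_mul _) ?_).2.differentiableAt
  · filter_upwards [Complex.isOpen_slitPlane.mem_nhds hx₀] with x hx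
    exact (hH.continuousOn_kernel hx hy _).aestronglyMeasurable measurableSet_Ioi
  · refine ContinuousOn.aestronglyMeasurable ?_ measurableSet_Ioi
    refine ContinuousOn.mul (ContinuousOn.mul (by fun_prop) ?_) (hH.continuousOn_kernel hx₀ hy _)
    refine ContinuousOn.inv₀ (by fun_prop) fun w hw => ?_
    exact Complex.slitPlane_ne_zero (mul_add_mem_slitPlane hx₀ hy (le_of_lt hw))
  · filter_upwards [ae_restrict_mem measurableSet_Ioi] with w hw x hx
    have hw' : 0 < w := hw
    have hl := hlow x hx.2 w hw
    rw [norm_mul]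
    refine mul_le_mul ?_ (HasGrowth.norm_kernel_le hd hw (hC w hw) (by linarith) hl)
      (norm_nonneg _) (by positivity)
    rw [norm_mul, norm_mul, norm_inv, norm_neg, Complex.norm_real, Complex.norm_real,
      Real.norm_of_nonneg hd, Real.norm_of_nonneg hw'.le, mul_assoc]
    refine mul_le_mul_of_nonneg_left ?_ hd
    have h1 : w ≤ 1 + w := by linarith
    have h2 : c / 2 * w ≤ ‖(w : ℂ) * x + y‖ :=
      (mul_le_mul_of_nonneg_left h1 (by linarith)).trans hl
    have h3 : 0 < ‖(w : ℂ) * x + y‖ := lt_of_lt_of_le (by positivity) hl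
    rw [← div_eq_mul_inv, div_le_iff₀ h3, ← div_eq_inv_mul, le_div_iff₀ (by linarith)]
    linarith
  · filter_upwards [ae_restrict_mem measurableSet_Ioi] with w hw x hx
    have hw' : 0 < w := hw
    have hm := mul_add_mem_slitPlane hx.1 hy hw'.le
    have h1 : HasDerivAt (fun x : ℂ => (w : ℂ) * x + y) (w * 1) x :=
      ((hasDerivAt_id x).const_mul _).add_const _
    refine ((h1.cpow_const hm (c := (-(d + 2 : ℝ) : ℂ))).const_mul (H w)).congr_deriv ?_
    rw [Complex.cpow_sub _ _ (Complex.slitPlane_ne_zero hm), Complex.cpow_one]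
    ring

lemma lineLaplace_smul {d : ℝ} {H : ℝ → ℂ} {x : ℂ} (hx : x ∈ Complex.slitPlane) {y : ℝ}
    (hy : 0 < y) {t : ℝ} (ht : 0 < t) :
    lineLaplace d H (t * x) (t * y) = (t : ℂ) ^ (-(d + 2 : ℝ) : ℂ) * lineLaplace d H x y := by
  rw [lineLaplace, lineLaplace, mul_left_comm]
  congr 1
  rw [← integral_const_mul]
  refine setIntegral_congr_fun measurableSet_Ioi fun w hw => ?_
  have hm := Complex.slitPlane_ne_zero (mul_add_mem_slitPlane hx hy (le_of_lt (mem_Ioi.1 hw)))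
  have h1 : (w : ℂ) * (t * x) + ((t * y : ℝ) : ℂ) = ((w : ℂ) * x + y) * t := by
    push_cast; ring
  simp only [h1, cpow_mul_ofReal hm ht]
  ring

/-! ### The Laplace transform of a homogeneous function on the quadrant -/

lemma exists_rpow_le_mul_exp {d : ℝ} (hd : 0 ≤ d) {e : ℝ} (he : 0 < e) :
    ∃ C : ℝ, 0 ≤ C ∧ ∀ t : ℝ, 0 ≤ t → t ^ d ≤ C * Real.exp (e * t) := by
  obtain ⟨N, hN⟩ := exists_nat_ge d
  refine ⟨1 + N.factorial / e ^ N, by positivity, fun t ht => ?_⟩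
  have h1 : t ^ d ≤ 1 + t ^ N := by
    rcases le_total t 1 with h | h
    · exact (Real.rpow_le_one ht h hd).trans (by linarith [pow_nonneg ht N])
    · rw [← Real.rpow_natCast t N]
      linarith [Real.rpow_le_rpow_of_exponent_le h hN]
  have h2 := Real.pow_div_factorial_le_exp (e * t) (by positivity) N
  have h3 : 1 ≤ Real.exp (e * t) := Real.one_le_exp (by positivity)
  have h4 : t ^ N ≤ N.factorial / e ^ N * Real.exp (e * t) := by
    rw [div_le_iff₀ (by positivity), mul_pow] at h2
    rw [div_mul_eq_mul_div, le_div_iff₀ (by positivity)]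
    linarith
  linarith

/-- `h` is homogeneous of degree `d` on the quadrant, continuous, and bounded by a multiple of
`(u + v)^d`. -/
structure IsHomogeneousOfDegree (d : ℝ) (h : ℝ → ℝ → ℂ) : Prop where
  continuousOn : ContinuousOn (fun p : ℝ × ℝ => h p.1 p.2) quadrant
  homogeneous : ∀ w v : ℝ, 0 < w → 0 < v → h (w * v) v = ((v ^ d : ℝ) : ℂ) * h w 1
  bound : ∃ C : ℝ, 0 ≤ C ∧ ∀ w : ℝ, 0 < w → ‖h w 1‖ ≤ C * (1 + w) ^ d

lemma IsHomogeneousOfDegree.hasGrowth {d : ℝ} {h : ℝ → ℝ → ℂ} (hh : IsHomogeneousOfDegree d h) :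
    HasGrowth d (fun w => h w 1) where
  continuousOn := hh.continuousOn.comp (f := fun w : ℝ => (w, (1 : ℝ))) (by fun_prop)
    fun w hw => ⟨hw, mem_Ioi.2 one_pos⟩
  bound := hh.bound

lemma measurableSet_quadrant : MeasurableSet quadrant := measurableSet_Ioi.prod measurableSet_Ioi

lemma IsHomogeneousOfDegree.norm_le {d : ℝ} {h : ℝ → ℝ → ℂ} {C : ℝ}
    (hh : IsHomogeneousOfDegree d h) (hC : ∀ w : ℝ, 0 < w → ‖h w 1‖ ≤ C * (1 + w) ^ d) {u v : ℝ}
    (hu : 0 < u) (hv : 0 < v) : ‖h u v‖ ≤ C * (u + v) ^ d := by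
  have h1 := hh.homogeneous (u / v) v (by positivity) hv
  rw [div_mul_cancel₀ _ hv.ne'] at h1
  rw [h1, norm_mul, Complex.norm_real, Real.norm_of_nonneg (by positivity)]
  have h2 : (u + v) ^ d = v ^ d * (1 + u / v) ^ d := by
    rw [← Real.mul_rpow hv.le (by positivity)]
    congr 1
    field_simp
    ring
  rw [h2]
  have := mul_le_mul_of_nonneg_left (hC (u / v) (by positivity)) (Real.rpow_nonneg hv.le d)
  linarith

lemma IsHomogeneousOfDegree.integrableOn {d : ℝ} (hd : 0 ≤ d) {h : ℝ → ℝ → ℂ}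
    (hh : IsHomogeneousOfDegree d h) {x : ℂ} {y : ℝ} (hx : 0 < x.re) (hy : 0 < y) :
    IntegrableOn (fun p : ℝ × ℝ => Complex.exp (-(p.1 * x) - p.2 * y) * h p.1 p.2) quadrant := by
  obtain ⟨C, hC0, hC⟩ := hh.bound
  -- The exponential decays at least like e^(-2e(u + v)); one half of this rate absorbs (u + v)^d
  -- and the other half remains integrable.
  set e := min x.re y / 2 with he
  have he0 : 0 < e := by positivity
  have hex : 2 * e ≤ x.re := by rw [he]; linarith [min_le_left x.re y]
  have hey : 2 * e ≤ y := by rw [he]; linarith [min_le_right x.re y]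
  obtain ⟨D, hD0, hD⟩ := exists_rpow_le_mul_exp hd he0
  have hint : IntegrableOn (fun u : ℝ => Real.exp (-e * u)) (Ioi 0) := integrableOn_exp_mul_Ioi (by linarith) 0
  have hprod : Integrable (fun p : ℝ × ℝ => Real.exp (-e * p.1) * Real.exp (-e * p.2))
      ((volume.restrict (Ioi 0)).prod (volume.restrict (Ioi 0))) := hint.mul_prod hint
  rw [Measure.prod_restrict] at hprod
  refine (hprod.const_mul (C * D)).mono' ?_ ?_
  · exact (ContinuousOn.mul (by fun_prop) hh.continuousOn).aestronglyMeasurable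
      measurableSet_quadrant
  · filter_upwards [ae_restrict_mem measurableSet_quadrant] with p hp
    have hu : 0 < p.1 := hp.1
    have hv : 0 < p.2 := hp.2
    have h1 := hh.norm_le hC hu hv
    have h2 := hD (p.1 + p.2) (by positivity)
    rw [norm_mul, Complex.norm_exp]
    have h3 : (-(p.1 * x) - p.2 * y : ℂ).re = -(p.1 * x.re) - p.2 * y := by simp
    rw [h3]
    calc Real.exp (-(p.1 * x.re) - p.2 * y) * ‖h p.1 p.2‖
        ≤ Real.exp (-2 * e * (p.1 + p.2)) * (C * (D * Real.exp (e * (p.1 + p.2)))) := by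
          refine mul_le_mul (Real.exp_le_exp.2 ?_) (h1.trans (mul_le_mul_of_nonneg_left h2 hC0))
            (norm_nonneg _) (Real.exp_nonneg _)
          nlinarith [mul_le_mul_of_nonneg_left hex hu.le, mul_le_mul_of_nonneg_left hey hv.le]
      _ = C * D * (Real.exp (-e * p.1) * Real.exp (-e * p.2)) := by
          have : -e * p.1 + -e * p.2 = -2 * e * (p.1 + p.2) + e * (p.1 + p.2) := by ring
          rw [← Real.exp_add (-e * p.1), this, Real.exp_add]
          ring

/-- Substitute u = w v for fixed v. By homogeneity the integrand splits into h(w, 1) and a power of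
v times an exponential, and after Fubini the v-integral is a Gamma integral with parameter w x + y.
-/
lemma IsHomogeneousOfDegree.isLaplaceTransform {d : ℝ} (hd : 0 ≤ d) {h : ℝ → ℝ → ℂ}
    (hh : IsHomogeneousOfDegree d h) : IsLaplaceTransform h (lineLaplace d fun w => h w 1) := by
  intro x y hx hy
  have hint := hh.integrableOn hd hx hy
  refine ⟨hint, ?_⟩
  have hd2 : (0 : ℝ) ≤ d + 2 := by linarith
  -- The exponent d + 1 is d from homogeneity plus 1 from the Jacobian of u = w v.
  set k : ℝ → ℝ → ℂ := fun v w =>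
    h w 1 * (((v ^ (d + 1) : ℝ) : ℂ) * Complex.exp (-(((w : ℂ) * x + y) * v))) with hk
  have hre : ∀ w : ℝ, 0 < w → 0 < ((w : ℂ) * x + y).re := by
    intro w hw
    simp only [Complex.add_re, Complex.re_ofReal_mul, Complex.ofReal_re]
    positivity
  have hkint : Integrable (Function.uncurry k)
      ((volume.restrict (Ioi 0)).prod (volume.restrict (Ioi 0))) := by
    have hmeas : AEStronglyMeasurable (Function.uncurry k)
        ((volume.restrict (Ioi (0 : ℝ))).prod (volume.restrict (Ioi 0))) := by
      rw [Measure.prod_restrict]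
      refine ContinuousOn.aestronglyMeasurable ?_ measurableSet_quadrant
      refine ContinuousOn.mul ?_ (ContinuousOn.mul ?_ (by fun_prop))
      · exact hh.hasGrowth.continuousOn.comp (f := fun p : ℝ × ℝ => p.2) (by fun_prop)
          fun p hp => hp.2
      · refine Complex.continuous_ofReal.comp_continuousOn (ContinuousOn.rpow_const (by fun_prop) fun p hp => ?_)
        exact Or.inl (ne_of_gt hp.1)
    rw [integrable_prod_iff' hmeas]
    constructor
    · filter_upwards [ae_restrict_mem measurableSet_Ioi] with w hw
      exact (integrableOn_ofReal_rpow_mul_exp (by linarith) (hre w hw)).const_mul (h w 1)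
    -- The norm of the integrand depends on x only through Re x, so its v-integral is the norm of
    -- the line kernel at the real point Re x.
    · have hx' : ((x.re : ℝ) : ℂ) ∈ Complex.slitPlane := Or.inl (by simpa using hx)
      have := ((hh.hasGrowth.integrableOn_kernel hd2 hx' hy).norm).const_mul (Real.Gamma (d + 2))
      refine this.congr ?_
      filter_upwards [ae_restrict_mem measurableSet_Ioi] with w hw
      have hw' : 0 < w := hw
      have hz : 0 < w * x.re + y := by positivity
      have e1 : ∀ v ∈ Ioi (0 : ℝ), ‖Function.uncurry k (v, w)‖
          = ‖h w 1‖ * (v ^ (d + 2 - 1) * Real.exp (-((w * x.re + y) * v))) := by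
        intro v hv
        simp only [Function.uncurry_apply_pair, hk]
        rw [norm_mul, norm_ofReal_rpow_mul_exp hv]
        simp only [Complex.add_re, Complex.re_ofReal_mul, Complex.ofReal_re]
        ring_nf
      rw [setIntegral_congr_fun measurableSet_Ioi e1, integral_const_mul,
        Real.integral_rpow_mul_exp_neg_mul_Ioi (by linarith) hz, norm_mul, ← Complex.ofReal_neg,
        Complex.norm_cpow_real]
      have e2 : ‖(w : ℂ) * (x.re : ℂ) + y‖ = w * x.re + y := by
        rw [← Complex.ofReal_mul, ← Complex.ofReal_add, Complex.norm_real,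
          Real.norm_of_nonneg hz.le]
      rw [e2, one_div, Real.inv_rpow hz.le, ← Real.rpow_neg hz.le]
      ring
  have hinner : ∀ v ∈ Ioi (0 : ℝ),
      ∫ u in Ioi (0 : ℝ), Complex.exp (-(u * x) - v * y) * h u v
        = ∫ w in Ioi (0 : ℝ), k v w := by
    intro v hv
    have hv' : 0 < v := hv
    have h1 := integral_comp_mul_right_Ioi'
      (fun u : ℝ => Complex.exp (-(u * x) - v * y) * h u v) 0 hv'
    rw [zero_mul] at h1
    rw [← h1, ← integral_smul]
    refine setIntegral_congr_fun measurableSet_Ioi fun w hw => ?_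
    have hw' : 0 < w := hw
    simp only [hk]
    rw [hh.homogeneous w v hw' hv', Complex.real_smul, Real.rpow_add_one hv'.ne']
    push_cast
    have e3 : (-(w * v * x) - v * y : ℂ) = -((w * x + y) * v) := by ring
    rw [e3]
    ring
  have hsymm : ∫ p in quadrant, Complex.exp (-(p.1 * x) - p.2 * y) * h p.1 p.2
      = ∫ v in Ioi (0 : ℝ), ∫ u in Ioi (0 : ℝ), Complex.exp (-(u * x) - v * y) * h u v := by
    have hint' := hint
    rw [IntegrableOn, quadrant, Measure.volume_eq_prod, ← Measure.prod_restrict] at hint'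
    rw [quadrant, Measure.volume_eq_prod, ← Measure.prod_restrict, integral_prod_symm _ hint']
  rw [hsymm, setIntegral_congr_fun measurableSet_Ioi hinner, integral_integral_swap hkint,
    lineLaplace, ← integral_const_mul]
  refine setIntegral_congr_fun measurableSet_Ioi fun w hw => ?_
  simp only [hk]
  rw [integral_const_mul]
  have h2 := integral_rpow_mul_cexp (a := d + 2) (by linarith) (hre w hw)
  have e4 : d + 2 - 1 = d + 1 := by ring
  rw [e4] at h2
  rw [h2]
  ring

/-! ### Twice differentiable functions on the quadrant and their Laplacian -/

/-- `h` has the second derivatives on the quadrant that enter `lap S h`, and `lap S h = g`. -/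
def HasLap (S : Matrix (Fin 2) (Fin 2) ℝ) (h g : ℝ → ℝ → ℂ) : Prop :=
  ∃ hu hv huu huv hvv : ℝ → ℝ → ℂ, ∀ u v : ℝ, 0 < u → 0 < v →
    HasDerivAt (fun t => h t v) (hu u v) u ∧ HasDerivAt (fun t => h u t) (hv u v) v ∧
    HasDerivAt (fun t => hu t v) (huu u v) u ∧ HasDerivAt (fun t => hv t v) (huv u v) u ∧
    HasDerivAt (fun t => hv u t) (hvv u v) v ∧
    (1 / 2) * ((S 0 0 : ℂ) * huu u v + 2 * (S 0 1 : ℂ) * huv u v + (S 1 1 : ℂ) * hvv u v) = g u v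

section HasLap

variable {S : Matrix (Fin 2) (Fin 2) ℝ} {h h' g g' : ℝ → ℝ → ℂ}

lemma HasLap.lap_eq (H : HasLap S h g) {u v : ℝ} (hu : 0 < u) (hv : 0 < v) :
    lap S h u v = g u v := by
  obtain ⟨hu', hv', huu, huv, hvv, H⟩ := H
  have e1 : (fun s => deriv (fun t => h t v) s) =ᶠ[𝓝 u] fun s => hu' s v := by
    filter_upwards [lt_mem_nhds hu] with s hs using (H s v hs hv).1.deriv
  have e2 : (fun s => deriv (fun t => h s t) v) =ᶠ[𝓝 u] fun s => hv' s v := by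
    filter_upwards [lt_mem_nhds hu] with s hs using (H s v hs hv).2.1.deriv
  have e3 : (fun s => deriv (fun t => h u t) s) =ᶠ[𝓝 v] fun s => hv' u s := by
    filter_upwards [lt_mem_nhds hv] with s hs using (H u s hu hs).2.1.deriv
  obtain ⟨-, -, h3, h4, h5, h6⟩ := H u v hu hv
  rw [lap, e1.deriv_eq, e2.deriv_eq, e3.deriv_eq, h3.deriv, h4.deriv, h5.deriv, h6]

lemma HasLap.congr (H : HasLap S h g) (hh : ∀ u v : ℝ, 0 < u → 0 < v → h' u v = h u v)
    (hg : ∀ u v : ℝ, 0 < u → 0 < v → g' u v = g u v) : HasLap S h' g' := by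
  obtain ⟨hu', hv', huu, huv, hvv, H⟩ := H
  refine ⟨hu', hv', huu, huv, hvv, fun u v hu hv => ?_⟩
  obtain ⟨h1, h2, h3, h4, h5, h6⟩ := H u v hu hv
  refine ⟨h1.congr_of_eventuallyEq ?_, h2.congr_of_eventuallyEq ?_, h3, h4, h5,
    h6.trans (hg u v hu hv).symm⟩
  · filter_upwards [lt_mem_nhds hu] with s hs using hh s v hs hv
  · filter_upwards [lt_mem_nhds hv] with s hs using hh u s hu hs

lemma HasLap.add_const_mul (H : HasLap S h g) (H' : HasLap S h' g') (c : ℂ) :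
    HasLap S (fun u v => h u v + c * h' u v) (fun u v => g u v + c * g' u v) := by
  obtain ⟨hu, hv, huu, huv, hvv, H⟩ := H
  obtain ⟨hu', hv', huu', huv', hvv', H'⟩ := H'
  refine ⟨fun u v => hu u v + c * hu' u v, fun u v => hv u v + c * hv' u v,
    fun u v => huu u v + c * huu' u v, fun u v => huv u v + c * huv' u v,
    fun u v => hvv u v + c * hvv' u v, fun u v hu hv => ?_⟩
  obtain ⟨h1, h2, h3, h4, h5, h6⟩ := H u v hu hv
  obtain ⟨k1, k2, k3, k4, k5, k6⟩ := H' u v hu hv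
  refine ⟨h1.add (k1.const_mul c), h2.add (k2.const_mul c), h3.add (k3.const_mul c),
    h4.add (k4.const_mul c), h5.add (k5.const_mul c), ?_⟩
  linear_combination h6 + c * k6

lemma hasLap_zero : HasLap S (fun _ _ => 0) (fun _ _ => 0) :=
  ⟨fun _ _ => 0, fun _ _ => 0, fun _ _ => 0, fun _ _ => 0, fun _ _ => 0, fun u v _ _ =>
    ⟨hasDerivAt_const _ _, hasDerivAt_const _ _, hasDerivAt_const _ _, hasDerivAt_const _ _,
      hasDerivAt_const _ _, by simp⟩⟩

lemma lap_congr (hh : ∀ u v : ℝ, 0 < u → 0 < v → h u v = h' u v) {u v : ℝ} (hu : 0 < u)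
    (hv : 0 < v) : lap S h u v = lap S h' u v := by
  have e1 : ∀ s, 0 < s → deriv (fun t => h t v) s = deriv (fun t => h' t v) s := fun s hs =>
    Filter.EventuallyEq.deriv_eq
      (by filter_upwards [lt_mem_nhds hs] with t ht using hh t v ht hv)
  have e2 : ∀ s r, 0 < s → 0 < r → deriv (fun t => h s t) r = deriv (fun t => h' s t) r :=
    fun s r hs hr => Filter.EventuallyEq.deriv_eq
      (by filter_upwards [lt_mem_nhds hr] with t ht using hh s t hs ht)
  have d1 : (fun s => deriv (fun t => h t v) s) =ᶠ[𝓝 u] fun s => deriv (fun t => h' t v) s := by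
    filter_upwards [lt_mem_nhds hu] with s hs using e1 s hs
  have d2 : (fun s => deriv (fun t => h s t) v) =ᶠ[𝓝 u] fun s => deriv (fun t => h' s t) v := by
    filter_upwards [lt_mem_nhds hu] with s hs using e2 s v hs hv
  have d3 : (fun s => deriv (fun t => h u t) s) =ᶠ[𝓝 v] fun s => deriv (fun t => h' u t) s := by
    filter_upwards [lt_mem_nhds hv] with s hs using e2 u s hu hs
  rw [lap, lap, d1.deriv_eq, d2.deriv_eq, d3.deriv_eq]

lemma iterate_lap_congr (n : ℕ) : ∀ {h h' : ℝ → ℝ → ℂ},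
    (∀ u v : ℝ, 0 < u → 0 < v → h u v = h' u v) →
    ∀ u v : ℝ, 0 < u → 0 < v → ((lap S)^[n] h) u v = ((lap S)^[n] h') u v := by
  induction n with
  | zero => exact fun hh => hh
  | succ n ih =>
    intro h h' hh
    rw [Function.iterate_succ_apply, Function.iterate_succ_apply]
    exact ih fun u v hu hv => lap_congr hh hu hv

end HasLap

/-! ### Monomials in two linear forms -/

/-- The function `(e u + v)^p (f u + v)^m`. -/
noncomputable def mono (e f p : ℂ) (m : ℕ) (u v : ℝ) : ℂ := (e * u + v) ^ p * (f * u + v) ^ m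

section Mono

variable {e f : ℂ}

lemma root_mul_add_mem (he : e ∈ Complex.slitPlane) {u v : ℝ} (hu : 0 ≤ u) (hv : 0 < v) :
    e * u + v ∈ Complex.slitPlane := by
  rw [mul_comm]
  exact mul_add_mem_slitPlane he hv hu

lemma hasDerivAt_mono_left (he : e ∈ Complex.slitPlane) (p : ℂ) (m : ℕ) {u v : ℝ} (hu : 0 ≤ u)
    (hv : 0 < v) : HasDerivAt (fun t => mono e f p m t v)
      (e * p * mono e f (p - 1) m u v + f * m * mono e f p (m - 1) u v) u := by
  have h1 : HasDerivAt (fun t : ℂ => e * t + v) (e * 1) (u : ℂ) :=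
    ((hasDerivAt_id _).const_mul e).add_const _
  have h2 : HasDerivAt (fun t : ℂ => f * t + v) (f * 1) (u : ℂ) :=
    ((hasDerivAt_id _).const_mul f).add_const _
  have h3 := ((h1.cpow_const (c := p) (root_mul_add_mem he hu hv)).mul (h2.pow m)).comp_ofReal
  refine h3.congr_deriv ?_
  simp only [mono, Pi.pow_apply]
  ring

lemma hasDerivAt_mono_right (he : e ∈ Complex.slitPlane) (p : ℂ) (m : ℕ) {u v : ℝ} (hu : 0 ≤ u)
    (hv : 0 < v) : HasDerivAt (fun t => mono e f p m u t)
      (p * mono e f (p - 1) m u v + m * mono e f p (m - 1) u v) v := by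
  have h1 : HasDerivAt (fun t : ℂ => e * u + t) 1 (v : ℂ) := (hasDerivAt_id _).const_add _
  have h2 : HasDerivAt (fun t : ℂ => f * u + t) 1 (v : ℂ) := (hasDerivAt_id _).const_add _
  have h3 := ((h1.cpow_const (c := p) (root_mul_add_mem he hu hv)).mul (h2.pow m)).comp_ofReal
  refine h3.congr_deriv ?_
  simp only [mono, Pi.pow_apply]
  ring

/-- Since e and f are roots of the quadratic form of Δ, differentiating the same factor twice
contributes nothing; only the mixed term survives. The truncated `m - 1` is harmless at m = 0
because of the factor m. -/
lemma hasLap_mono {S : Matrix (Fin 2) (Fin 2) ℝ} (he : e ∈ Complex.slitPlane)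
    (hge : (S 0 0 : ℂ) * e ^ 2 + 2 * (S 0 1 : ℂ) * e + (S 1 1 : ℂ) = 0)
    (hgf : (S 0 0 : ℂ) * f ^ 2 + 2 * (S 0 1 : ℂ) * f + (S 1 1 : ℂ) = 0) (p : ℂ) (m : ℕ) :
    HasLap S (mono e f p m) (fun u v => ((S 0 0 : ℂ) * (e * f) + (S 0 1 : ℂ) * (e + f)
      + (S 1 1 : ℂ)) * p * m * mono e f (p - 1) (m - 1) u v) := by
  refine ⟨_, _, _, _, _, fun u v hu hv => ⟨hasDerivAt_mono_left he p m hu.le hv,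
    hasDerivAt_mono_right he p m hu.le hv,
    ((hasDerivAt_mono_left he (p - 1) m hu.le hv).const_mul (e * p)).add
      ((hasDerivAt_mono_left he p (m - 1) hu.le hv).const_mul (f * m)),
    ((hasDerivAt_mono_left he (p - 1) m hu.le hv).const_mul p).add
      ((hasDerivAt_mono_left he p (m - 1) hu.le hv).const_mul (m : ℂ)),
    ((hasDerivAt_mono_right he (p - 1) m hu.le hv).const_mul p).add
      ((hasDerivAt_mono_right he p (m - 1) hu.le hv).const_mul (m : ℂ)), ?_⟩⟩
  linear_combination (1 / 2 * p * (p - 1) * mono e f (p - 1 - 1) m u v) * hge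
    + (1 / 2 * m * (m - 1 : ℕ) * mono e f p (m - 1 - 1) u v) * hgf

lemma norm_linear_le (e : ℂ) {w : ℝ} (hw : 0 ≤ w) : ‖e * w + (1 : ℝ)‖ ≤ (1 + ‖e‖) * (1 + w) := by
  refine (norm_add_le _ _).trans ?_
  rw [norm_mul, Complex.norm_real, Complex.norm_real, Real.norm_of_nonneg hw, norm_one]
  nlinarith [norm_nonneg e]

lemma norm_mono_le (e f : ℂ) {p : ℝ} (hp : 0 ≤ p) (m : ℕ) {w : ℝ} (hw : 0 ≤ w) :
    ‖mono e f p m w 1‖ ≤ (1 + ‖e‖) ^ p * (1 + ‖f‖) ^ m * (1 + w) ^ (p + m) := by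
  have h1 : 0 < 1 + w := by linarith
  rw [mono, norm_mul, norm_pow, Complex.norm_cpow_real, Real.rpow_add_natCast h1.ne']
  calc _ ≤ ((1 + ‖e‖) * (1 + w)) ^ p * ((1 + ‖f‖) * (1 + w)) ^ m := by
        gcongr
        · exact norm_linear_le e hw
        · exact norm_linear_le f hw
    _ = _ := by
        rw [Real.mul_rpow (by positivity) h1.le, mul_pow]
        ring

lemma hasGrowth_mono (he : e ∈ Complex.slitPlane) {p : ℝ} (hp : 0 ≤ p) (m : ℕ) :
    HasGrowth (p + m) (fun w => mono e f p m w 1) where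
  continuousOn := fun _ hw =>
    (hasDerivAt_mono_left he p m (le_of_lt hw) one_pos).continuousAt.continuousWithinAt
  bound := ⟨_, by positivity, fun _ hw => norm_mono_le e f hp m hw.le⟩

lemma mono_mul (p : ℝ) (m : ℕ) {u v t : ℝ}
    (h0 : e * u + v ≠ 0) (ht : 0 < t) :
    mono e f p m (u * t) (v * t) = ((t ^ (p + m) : ℝ) : ℂ) * mono e f p m u v := by
  have h1 : e * (u * t : ℝ) + (v * t : ℝ) = (e * u + v) * t := by push_cast; ring
  have h2 : f * (u * t : ℝ) + (v * t : ℝ) = (f * u + v) * t := by push_cast; ring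
  rw [mono, mono, h1, h2, cpow_mul_ofReal h0 ht, Real.rpow_add_natCast ht.ne',
    ← Complex.ofReal_cpow ht.le, mul_pow]
  push_cast
  ring

end Mono

/-! ### The functions `r^(b + 2m) sin (b φ)` -/

/-- The function `r^(jπ/θ + 2m) sin ((jπ/θ) φ)` in the polar coordinates of `c₊ u + v`. -/
noncomputable def wedge (S : Matrix (Fin 2) (Fin 2) ℝ) (j m : ℕ) (u v : ℝ) : ℂ :=
  ((mono (cPlus S) (cMinus S) ((j * beta S + m : ℝ) : ℂ) m u v).im : ℂ)

section Wedge

variable {S : Matrix (Fin 2) (Fin 2) ℝ}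

lemma cPlus_mem (hS : S.PosDef) : cPlus S ∈ Complex.slitPlane := by
  simpa using cPlus_mul_mem hS one_pos

lemma cMinus_mem (hS : S.PosDef) : cMinus S ∈ Complex.slitPlane := by
  simpa using cMinus_mul_mem hS one_pos

lemma cPlus_root (hS : S.PosDef) :
    (S 0 0 : ℂ) * cPlus S ^ 2 + 2 * (S 0 1 : ℂ) * cPlus S + (S 1 1 : ℂ) = 0 := by
  linear_combination cPlus S * cPlus_add_cMinus hS - cPlus_mul_cMinus hS

lemma cMinus_root (hS : S.PosDef) :
    (S 0 0 : ℂ) * cMinus S ^ 2 + 2 * (S 0 1 : ℂ) * cMinus S + (S 1 1 : ℂ) = 0 := by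
  linear_combination cMinus S * cPlus_add_cMinus hS - cPlus_mul_cMinus hS

/-- The constant `κ` with `Δ = κ ∂_z ∂_z̄` for `z = c₊ u + v`. -/
noncomputable def kap (S : Matrix (Fin 2) (Fin 2) ℝ) : ℝ := 2 * S 0 0 * height S ^ 2

lemma kap_eq (hS : S.PosDef) : (S 0 0 : ℂ) * (cPlus S * cMinus S)
    + (S 0 1 : ℂ) * (cPlus S + cMinus S) + (S 1 1 : ℂ) = kap S := by
  have h : (S 0 0 : ℂ) * (cPlus S - cMinus S) ^ 2 = -4 * S 0 0 * (height S) ^ 2 := by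
    rw [cPlus_sub_cMinus, mul_pow, Complex.I_sq]; ring
  rw [kap]
  push_cast
  linear_combination (-1 / 2) * h + (1 / 2) * (cPlus S + cMinus S) * cPlus_add_cMinus hS
    - cPlus_mul_cMinus hS

lemma mul_sq_cPlus_sub_cMinus : (S 0 0 : ℂ) / 2 * (cPlus S - cMinus S) ^ 2 = -(kap S : ℂ) := by
  rw [cPlus_sub_cMinus, mul_pow, Complex.I_sq, kap]
  push_cast
  ring

lemma kap_pos (hS : S.PosDef) : 0 < kap S := by
  have := S00_pos hS
  have := height_pos hS
  rw [kap]
  positivity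

/-- Conjugation exchanges the two monomials because u and v are real and c₊ u + v is off the cut. In
this form `hasLap_mono` and the integral formulas apply to each term. -/
lemma wedge_eq (hS : S.PosDef) (j m : ℕ) {u v : ℝ} (hu : 0 ≤ u) (hv : 0 < v) :
    wedge S j m u v = (mono (cPlus S) (cMinus S) ((j * beta S + m : ℝ) : ℂ) m u v
      - mono (cMinus S) (cPlus S) ((j * beta S + m : ℝ) : ℂ) m u v) / (2 * Complex.I) := by
  have hconj : (starRingEnd ℂ) (mono (cPlus S) (cMinus S) ((j * beta S + m : ℝ) : ℂ) m u v)
      = mono (cMinus S) (cPlus S) ((j * beta S + m : ℝ) : ℂ) m u v := by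
    have hm := root_mul_add_mem (cPlus_mem hS) hu hv
    have h := Complex.cpow_conj (cPlus S * u + v) ((j * beta S + m : ℝ) : ℂ)
      (Complex.mem_slitPlane_iff_arg.1 hm).1
    have hc : (starRingEnd ℂ) (cMinus S) = cPlus S := by
      rw [← conj_cPlus, Complex.conj_conj]
    have h2 : (starRingEnd ℂ) (cPlus S * u + v) = cMinus S * u + v := by
      simp [conj_cPlus]
    rw [h2, Complex.conj_ofReal] at h
    have h3 : (starRingEnd ℂ) ((cPlus S * u + v) ^ ((j * beta S + m : ℝ) : ℂ))
        = (cMinus S * u + v) ^ ((j * beta S + m : ℝ) : ℂ) := by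
      rw [h, Complex.conj_conj]
    rw [mono, mono, map_mul, map_pow, h3]
    simp [hc]
  rw [wedge, ← hconj, Complex.sub_conj]
  field_simp
  push_cast
  ring

lemma hasLap_wedge_aux (hS : S.PosDef) (j m : ℕ) :
    HasLap S (wedge S j m) (fun u v => kap S * (j * beta S + m : ℝ) * m *
      ((mono (cPlus S) (cMinus S) ((j * beta S + m : ℝ) - 1) (m - 1) u v
      - mono (cMinus S) (cPlus S) ((j * beta S + m : ℝ) - 1) (m - 1) u v) / (2 * Complex.I))) := by
  have h1 := hasLap_mono (cPlus_mem hS) (cPlus_root hS) (cMinus_root hS)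
    ((j * beta S + m : ℝ) : ℂ) m
  have h2 := hasLap_mono (cMinus_mem hS) (cMinus_root hS) (cPlus_root hS)
    ((j * beta S + m : ℝ) : ℂ) m
  have h3 := (hasLap_zero (S := S)).add_const_mul (h1.add_const_mul h2 (-1)) (1 / (2 * Complex.I))
  -- The mixed constant is symmetric in the two roots, so both monomials carry the same κ.
  rw [mul_comm (cMinus S), add_comm (cMinus S), kap_eq hS] at h3
  refine h3.congr (fun u v hu hv => ?_) (fun u v hu hv => ?_)
  · rw [wedge_eq hS j m hu.le hv]; ring
  · ring

lemma hasLap_wedge_zero (hS : S.PosDef) (j : ℕ) : HasLap S (wedge S j 0) (fun _ _ => 0) :=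
  (hasLap_wedge_aux hS j 0).congr (fun _ _ _ _ => rfl) fun u v _ _ => by simp

lemma hasLap_wedge_succ (hS : S.PosDef) (j m : ℕ) :
    HasLap S (wedge S j (m + 1)) (fun u v =>
      ((kap S * (j * beta S + (m + 1 : ℕ)) * (m + 1 : ℕ) : ℝ) : ℂ) * wedge S j m u v) := by
  refine (hasLap_wedge_aux hS j (m + 1)).congr (fun _ _ _ _ => rfl) fun u v hu hv => ?_
  have : ((j * beta S + m : ℝ) : ℂ) = ((j * beta S + (m + 1 : ℕ) : ℝ) : ℂ) - 1 := by
    push_cast; ring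
  rw [wedge_eq hS j m hu.le hv, this, Nat.add_sub_cancel]
  push_cast
  ring

lemma exponent_pos (hS : S.PosDef) {j : ℕ} (hj : 1 ≤ j) : 1 < j * beta S := by
  have h1 := one_lt_beta hS
  have h2 : (1 : ℝ) ≤ j := by exact_mod_cast hj
  nlinarith

lemma contDiffOn_wedge (hS : S.PosDef) (j m : ℕ) :
    ContDiffOn ℝ ∞ (fun p : ℝ × ℝ => wedge S j m p.1 p.2) quadrant := by
  intro p hp
  apply ContDiffAt.contDiffWithinAt
  have hu : 0 < p.1 := hp.1
  have hv : 0 < p.2 := hp.2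
  have hm := root_mul_add_mem (cPlus_mem hS) hu.le hv
  have hlin : ∀ e : ℂ, ContDiffAt ℝ ∞ (fun q : ℝ × ℝ => e * (q.1 : ℂ) + (q.2 : ℂ)) p := by
    intro e
    have h1 : ContDiff ℝ ∞ (fun q : ℝ × ℝ => (q.1 : ℂ)) := Complex.ofRealCLM.contDiff.comp contDiff_fst
    have h2 : ContDiff ℝ ∞ (fun q : ℝ × ℝ => (q.2 : ℂ)) := Complex.ofRealCLM.contDiff.comp contDiff_snd
    exact ((contDiff_const.mul h1).add h2).contDiffAt
  have hpow : ContDiffAt ℝ ∞ (fun q : ℝ × ℝ =>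
      (cPlus S * (q.1 : ℂ) + (q.2 : ℂ)) ^ ((j * beta S + m : ℝ) : ℂ)) p := by
    have hlog : ContDiffAt ℝ ∞ Complex.log (cPlus S * (p.1 : ℂ) + (p.2 : ℂ)) :=
      (Complex.contDiffAt_log hm).restrict_scalars ℝ
    have h1 := ((hlog.comp p (hlin (cPlus S))).mul
      (contDiffAt_const (c := ((j * beta S + m : ℝ) : ℂ)))).cexp
    refine h1.congr_of_eventuallyEq ?_
    have : ContinuousAt (fun q : ℝ × ℝ => cPlus S * (q.1 : ℂ) + (q.2 : ℂ)) p := by fun_prop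
    filter_upwards [this (Complex.isOpen_slitPlane.mem_nhds hm)] with q hq
    exact Complex.cpow_def_of_ne_zero (Complex.slitPlane_ne_zero hq) _
  exact (Complex.ofRealCLM.contDiff.comp Complex.imCLM.contDiff).contDiffAt.comp p
    (hpow.mul ((hlin (cMinus S)).pow m))

/-- On the closed quadrant c₊ u + v meets the cut only at the origin, where the power is continuous
because its exponent is positive. -/
lemma continuousOn_wedge (hS : S.PosDef) {j : ℕ} (hj : 1 ≤ j) (m : ℕ) :
    ContinuousOn (fun p : ℝ × ℝ => wedge S j m p.1 p.2) (Ici 0 ×ˢ Ici 0) := by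
  intro p hp
  have hu : 0 ≤ p.1 := hp.1
  have hv : 0 ≤ p.2 := hp.2
  apply ContinuousAt.continuousWithinAt
  have hlin : ∀ e : ℂ, ContinuousAt (fun q : ℝ × ℝ => e * (q.1 : ℂ) + (q.2 : ℂ)) p := by
    intro e; fun_prop
  have hpow : ContinuousAt (fun q : ℝ × ℝ =>
      (cPlus S * (q.1 : ℂ) + (q.2 : ℂ)) ^ ((j * beta S + m : ℝ) : ℂ)) p := by
    refine ContinuousAt.comp (f := fun q : ℝ × ℝ => cPlus S * (q.1 : ℂ) + (q.2 : ℂ))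
      (g := fun z : ℂ => z ^ ((j * beta S + m : ℝ) : ℂ))
      (Complex.continuousAt_cpow_const_of_re_pos ?_ ?_) (hlin _)
    · rcases hu.eq_or_lt with h | h
      · left; simp [← h, hv]
      · right
        simp only [Complex.add_im, Complex.im_mul_ofReal, Complex.ofReal_im, add_zero, cPlus_im]
        exact (mul_pos (height_pos hS) h).ne'
    · have := exponent_pos hS hj
      rw [Complex.ofReal_re]
      positivity
  exact (Complex.continuous_ofReal.comp Complex.continuous_im).continuousAt.comp
    (f := fun q : ℝ × ℝ => mono (cPlus S) (cMinus S) ((j * beta S + m : ℝ) : ℂ) m q.1 q.2)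
    (hpow.mul ((hlin (cMinus S)).pow m))

lemma wedge_zero_left (j m : ℕ) {v : ℝ} (hv : 0 ≤ v) : wedge S j m 0 v = 0 := by
  rw [wedge, mono, Complex.ofReal_zero, mul_zero, mul_zero, zero_add, ← Complex.ofReal_cpow hv,
    ← Complex.ofReal_pow, ← Complex.ofReal_mul, Complex.ofReal_im, Complex.ofReal_zero]

/-- The value of `c₊^(b + m) c₋^m`. -/
lemma cPlus_cpow_mul_cMinus_pow (hS : S.PosDef) (j m : ℕ) :
    cPlus S ^ ((j * beta S + m : ℝ) : ℂ) * cMinus S ^ m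
      = (((-1) ^ j * modulus S ^ (j * beta S + 2 * m) : ℝ) : ℂ) := by
  have hc := modulus_pos hS
  have h1 := cMinus_cpow hS (m : ℝ)
  rw [Complex.ofReal_natCast, Complex.cpow_natCast] at h1
  rw [cPlus_cpow hS, h1, mul_mul_mul_comm, ← Complex.exp_add, ← Complex.ofReal_mul,
    ← Real.rpow_add hc]
  have h2 : ((theta S * (j * beta S + m) : ℝ) : ℂ) * Complex.I + -((theta S * m : ℝ) * Complex.I)
      = ((j * Real.pi : ℝ) : ℂ) * Complex.I := by
    rw [← beta_mul_theta hS]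
    push_cast
    ring
  rw [h2, exp_natCast_pi]
  push_cast
  ring_nf

lemma cMinus_cpow_mul_cPlus_pow (hS : S.PosDef) (j m : ℕ) :
    cMinus S ^ ((j * beta S + m : ℝ) : ℂ) * cPlus S ^ m
      = (((-1) ^ j * modulus S ^ (j * beta S + 2 * m) : ℝ) : ℂ) := by
  have hc := modulus_pos hS
  have h1 := cPlus_cpow hS (m : ℝ)
  rw [Complex.ofReal_natCast, Complex.cpow_natCast] at h1
  rw [cMinus_cpow hS, h1, mul_mul_mul_comm, ← Complex.exp_add, ← Complex.ofReal_mul,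
    ← Real.rpow_add hc]
  have h2 : -(((theta S * (j * beta S + m) : ℝ) : ℂ) * Complex.I) + (theta S * m : ℝ) * Complex.I
      = -(((j * Real.pi : ℝ) : ℂ) * Complex.I) := by
    rw [← beta_mul_theta hS]
    push_cast
    ring
  rw [h2, exp_neg_natCast_pi]
  push_cast
  ring_nf

/-- On this side z = c₊ u has argument θ, so z^(jπ/θ + m) z̄^m has argument jπ and is real. This is
what forces the exponents to be multiples of π/θ. -/
lemma wedge_zero_right (hS : S.PosDef) {j : ℕ} (hj : 1 ≤ j) (m : ℕ) {u : ℝ} (hu : 0 ≤ u) :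
    wedge S j m u 0 = 0 := by
  have hp := exponent_pos hS hj
  rcases hu.eq_or_lt with rfl | hu
  · exact wedge_zero_left j m le_rfl
  · have h := mono_mul (e := cPlus S) (f := cMinus S) (j * beta S + m) m (u := 1) (v := 0) (t := u)
      (by simpa using cPlus_ne_zero hS) hu
    rw [one_mul, zero_mul] at h
    rw [wedge, h, Complex.im_ofReal_mul, mono, Complex.ofReal_zero, Complex.ofReal_one, mul_one,
      add_zero, mul_one, add_zero, cPlus_cpow_mul_cMinus_pow hS, Complex.ofReal_im, mul_zero,
      Complex.ofReal_zero]

lemma isHomogeneousOfDegree_wedge (hS : S.PosDef) {j : ℕ} (hj : 1 ≤ j) (m : ℕ) :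
    IsHomogeneousOfDegree (j * beta S + 2 * m) (wedge S j m) where
  continuousOn := (contDiffOn_wedge hS j m).continuousOn
  homogeneous w v hw hv := by
    have h := mono_mul (e := cPlus S) (f := cMinus S) (j * beta S + m) m (u := w) (v := 1) (t := v)
      (Complex.slitPlane_ne_zero (root_mul_add_mem (cPlus_mem hS) hw.le one_pos)) hv
    rw [one_mul] at h
    rw [wedge, wedge, h, Complex.im_ofReal_mul, Complex.ofReal_mul]
    ring_nf
  bound := by
    have hp := exponent_pos hS hj
    refine ⟨(1 + ‖cPlus S‖) ^ (j * beta S + m) * (1 + ‖cMinus S‖) ^ m, by positivity,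
      fun w hw => ?_⟩
    have h := norm_mono_le (cPlus S) (cMinus S) (p := j * beta S + m) (by positivity) m hw.le
    have e : j * beta S + m + m = j * beta S + 2 * m := by ring
    rw [e] at h
    rw [wedge, Complex.norm_real]
    exact (Complex.abs_im_le_norm _).trans h

end Wedge

/-! ### The functional equation of the transforms -/

section FunctionalEquation

variable {e f : ℂ}

/-- The antiderivative that yields the functional equation. -/
noncomputable def primitive (e f p : ℂ) (m : ℕ) (d : ℝ) (x : ℂ) (y w s : ℝ) : ℂ :=
  -((p * (x - f * y)) * (e * w + s) + (m * (x - e * y)) * (f * w + s)) * mono e f p m w s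
    * (w * x + (s * y : ℝ)) ^ (-(d + 1 : ℝ) : ℂ)

lemma hasDerivAt_primitive (he : e ∈ Complex.slitPlane) {x : ℂ} (hx : x ∈ Complex.slitPlane)
    {y : ℝ} (hy : 0 < y) {p d : ℝ} (m : ℕ) (hd : d = p + m) {w : ℝ} (hw : 0 ≤ w) :
    HasDerivAt (fun w => primitive e f p m d x y w 1)
      ((d + 1) * d * ((x - e * y) * (x - f * y))
          * (mono e f p m w 1 * (w * x + y) ^ (-(d + 2 : ℝ) : ℂ))
        + (e - f) ^ 2 * p * m * (mono e f (p - 1) (m - 1) w 1 * (w * x + y) ^ (-(d : ℝ) : ℂ))) w := by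
  have hT := mul_add_mem_slitPlane hx hy hw
  have hT0 := Complex.slitPlane_ne_zero hT
  have hZ0 := Complex.slitPlane_ne_zero (root_mul_add_mem he hw one_pos)
  have hlin : ∀ a b : ℂ, HasDerivAt (fun w : ℝ => a * (w : ℂ) + b) a w := fun a b => by
    simpa using (((hasDerivAt_id (w : ℂ)).const_mul a).add_const b).comp_ofReal
  have h1 := (((hlin e (1 : ℝ)).const_mul ((p : ℂ) * (x - f * y))).add
    ((hlin f (1 : ℝ)).const_mul ((m : ℂ) * (x - e * y)))).neg
  have h2 : HasDerivAt (fun w : ℝ => ((w : ℂ) * x + ((1 * y : ℝ) : ℂ)) ^ (-(d + 1 : ℝ) : ℂ))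
      ((-(d + 1 : ℝ) : ℂ) * (w * x + y) ^ (-(d + 1 : ℝ) - 1 : ℂ) * x) w := by
    have h3 : HasDerivAt (fun z : ℂ => z * x + ((1 * y : ℝ) : ℂ)) (1 * x) (w : ℂ) :=
      ((hasDerivAt_id (w : ℂ)).mul_const x).add_const _
    have h4 := (h3.cpow_const (c := (-(d + 1 : ℝ) : ℂ)) (by rwa [one_mul])).comp_ofReal
    simpa [one_mul] using h4
  have h5 := (h1.mul (hasDerivAt_mono_left (f := f) he p m hw one_pos)).mul h2
  refine h5.congr_deriv ?_
  -- All powers are reduced to the lowest exponents that occur, p - 1 and -(d + 2); what remains is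
  -- a polynomial identity.
  have eZ : (e * w + (1 : ℝ)) ^ (p : ℂ) = (e * w + (1 : ℝ)) ^ ((p : ℂ) - 1) * (e * w + 1) := by
    rw [Complex.cpow_sub _ _ hZ0, Complex.cpow_one]
    simp only [Complex.ofReal_one] at hZ0 ⊢
    field_simp
  have eT1 : (w * x + y) ^ (-(d + 1 : ℝ) : ℂ)
      = (w * x + y) ^ (-(d + 2 : ℝ) : ℂ) * (w * x + y) := by
    have : (-(d + 1 : ℝ) : ℂ) = (-(d + 2 : ℝ) : ℂ) + 1 := by push_cast; ring
    rw [this, Complex.cpow_add _ _ hT0, Complex.cpow_one]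
  have eT0 : (w * x + y) ^ (-(d : ℝ) : ℂ)
      = (w * x + y) ^ (-(d + 2 : ℝ) : ℂ) * (w * x + y) ^ 2 := by
    have : (-(d : ℝ) : ℂ) = (-(d + 2 : ℝ) : ℂ) + (2 : ℕ) := by push_cast; ring
    rw [this, Complex.cpow_add _ _ hT0, Complex.cpow_natCast]
  have eT2 : (-(d + 1 : ℝ) - 1 : ℂ) = (-(d + 2 : ℝ) : ℂ) := by push_cast; ring
  rw [eT2, eT0]
  simp only [Pi.neg_apply, Pi.add_apply, Pi.mul_apply, mono, one_mul, eT1, eZ]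
  generalize (w * x + y) ^ (-(d + 2 : ℝ) : ℂ) = C
  generalize (e * w + (1 : ℝ)) ^ ((p : ℂ) - 1) = A
  subst hd
  rcases m with _ | m
  · push_cast
    ring
  · rw [Nat.add_sub_cancel, pow_succ]
    generalize (f * w + (1 : ℝ)) ^ m = B
    push_cast
    ring

/-- The antiderivative is homogeneous of degree 0 in (w, s), since 1 + (p + m) - (d + 1) = 0. Its
value at (w, 1) is therefore its value at (1, 1/w), which tends to that at (1, 0). -/
lemma tendsto_primitive (he : e ∈ Complex.slitPlane) {x : ℂ} (hx : x ∈ Complex.slitPlane)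
    {y : ℝ} {p d : ℝ} (m : ℕ) (hd : d = p + m) (hy : 0 < y) :
    Tendsto (fun w => primitive e f p m d x y w 1) atTop (𝓝 (primitive e f p m d x y 1 0)) := by
  have hcont : ContinuousAt (fun s : ℝ => primitive e f p m d x y 1 s) 0 := by
    have hlin : ∀ a : ℂ, ContinuousAt (fun s : ℝ => a * ((1 : ℝ) : ℂ) + (s : ℂ)) 0 := fun a => by
      fun_prop
    have h1 : ContinuousAt (fun s : ℝ => mono e f p m 1 s) 0 :=
      ((hlin e).cpow continuousAt_const (by simpa using he)).mul ((hlin f).pow m)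
    have h2 : ContinuousAt (fun s : ℝ => (((1 : ℝ) : ℂ) * x + ((s * y : ℝ) : ℂ)) ^ (-(d + 1 : ℝ) : ℂ)) 0 :=
      ContinuousAt.cpow (by fun_prop) continuousAt_const (by simpa using hx)
    exact (((((hlin e).const_mul _).add ((hlin f).const_mul _)).neg).mul h1).mul h2
  have h3 : Tendsto (fun w : ℝ => primitive e f p m d x y 1 w⁻¹) atTop
      (𝓝 (primitive e f p m d x y 1 0)) := hcont.tendsto.comp tendsto_inv_atTop_zero
  refine h3.congr' ?_
  filter_upwards [eventually_gt_atTop 0] with w hw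
  have hw0 : (w : ℂ) ≠ 0 := by exact_mod_cast hw.ne'
  have hZ0 := Complex.slitPlane_ne_zero (root_mul_add_mem he (zero_le_one (α := ℝ)) (inv_pos.2 hw))
  have hm := mono_mul (f := f) p m hZ0 hw
  have hT0 : ((1 : ℝ) : ℂ) * x + ((w⁻¹ * y : ℝ) : ℂ) ≠ 0 := Complex.slitPlane_ne_zero
    (mul_add_mem_slitPlane hx (mul_pos (inv_pos.2 hw) hy) zero_le_one)
  rw [one_mul, inv_mul_cancel₀ hw.ne'] at hm
  have hT : (w : ℂ) * x + ((1 * y : ℝ) : ℂ) = (((1 : ℝ) : ℂ) * x + ((w⁻¹ * y : ℝ) : ℂ)) * w := by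
    push_cast
    field_simp
  have hl : ∀ a : ℂ, a * (w : ℂ) + ((1 : ℝ) : ℂ) = (a * ((1 : ℝ) : ℂ) + ((w⁻¹ : ℝ) : ℂ)) * w := by
    intro a
    push_cast
    field_simp
  have hpow : (w : ℂ) * ((w ^ (p + m) : ℝ) : ℂ) * (w : ℂ) ^ (-(d + 1 : ℝ) : ℂ) = 1 := by
    rw [← hd, ← Complex.ofReal_neg, ← Complex.ofReal_cpow hw.le, ← Complex.ofReal_mul,
      ← Complex.ofReal_mul, mul_comm w, ← Real.rpow_add_one hw.ne', ← Real.rpow_add hw]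
    simp
  rw [primitive, primitive, hm, hT, cpow_mul_ofReal hT0 hw, hl e, hl f]
  linear_combination (-(((p * (x - f * y)) * (e * ((1 : ℝ) : ℂ) + ((w⁻¹ : ℝ) : ℂ))
    + (m * (x - e * y)) * (f * ((1 : ℝ) : ℂ) + ((w⁻¹ : ℝ) : ℂ))) * mono e f p m 1 w⁻¹
    * (((1 : ℝ) : ℂ) * x + ((w⁻¹ * y : ℝ) : ℂ)) ^ (-(d + 1 : ℝ) : ℂ))) * (-hpow)

/-- The fundamental theorem of calculus for `primitive`: the end w = 0 yields the power of y, the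
end w = ∞ the power of x. -/
lemma integral_mono (he : e ∈ Complex.slitPlane) {x : ℂ} (hx : x ∈ Complex.slitPlane)
    {y : ℝ} (hy : 0 < y) {p d : ℝ} (hp : 1 ≤ p) (m : ℕ) (hd : d = p + m) :
    (d + 1) * d * ((x - e * y) * (x - f * y))
        * (∫ w in Ioi (0 : ℝ), mono e f p m w 1 * (w * x + y) ^ (-(d + 2 : ℝ) : ℂ))
      + (e - f) ^ 2 * p * m
        * (∫ w in Ioi (0 : ℝ), mono e f (p - 1) (m - 1) w 1 * (w * x + y) ^ (-(d : ℝ) : ℂ))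
      = (p * (x - f * y) + m * (x - e * y)) * (y : ℂ) ^ (-(d + 1 : ℝ) : ℂ)
        - (p * (x - f * y) * e + m * (x - e * y) * f) * (e ^ (p : ℂ) * f ^ m)
          * x ^ (-(d + 1 : ℝ) : ℂ) := by
  have hi1 : IntegrableOn
      (fun w : ℝ => mono e f p m w 1 * (w * x + y) ^ (-(d + 2 : ℝ) : ℂ)) (Ioi 0) := by
    rw [hd]
    exact (hasGrowth_mono he (by linarith) m).integrableOn_kernel (by positivity) hx hy
  have hi2 : IntegrableOn (fun w : ℝ => (e - f) ^ 2 * p * m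
      * (mono e f (p - 1) (m - 1) w 1 * (w * x + y) ^ (-(d : ℝ) : ℂ))) (Ioi 0) := by
    rcases m with _ | m
    · simp
    · refine Integrable.const_mul ?_ _
      have h := (hasGrowth_mono (f := f) he (p := p - 1) (by linarith) m).integrableOn_kernel
        (by linarith [(Nat.cast_nonneg m : (0 : ℝ) ≤ m)]) hx hy
      have e1 : p - 1 + m + 2 = d := by rw [hd]; push_cast; ring
      rw [e1] at h
      simpa [IntegrableOn] using h
  have hder : ∀ w ∈ Ici (0 : ℝ), _ := fun w hw =>
    hasDerivAt_primitive (f := f) he hx hy m hd (mem_Ici.1 hw)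
  have h := integral_Ioi_of_hasDerivAt_of_tendsto
    (hder 0 self_mem_Ici).continuousAt.continuousWithinAt (fun w hw => hder w (le_of_lt (mem_Ioi.1 hw)))
    ((hi1.const_mul _).add hi2) (tendsto_primitive he hx m hd hy)
  rw [integral_add (hi1.const_mul _) hi2, integral_const_mul, integral_const_mul] at h
  rw [h, primitive, primitive, mono, mono]
  simp
  ring

end FunctionalEquation

/-! ### Transforms of the wedge functions -/

section WedgeLaplace

variable {S : Matrix (Fin 2) (Fin 2) ℝ}

/-- The Laplace transform of `wedge S j m`, continued to the slit plane. -/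
noncomputable def wedgeLaplace (S : Matrix (Fin 2) (Fin 2) ℝ) (j m : ℕ) : ℂ → ℝ → ℂ :=
  lineLaplace (j * beta S + 2 * m) fun w => wedge S j m w 1

lemma integral_wedge (hS : S.PosDef) {j : ℕ} (hj : 1 ≤ j) (m : ℕ) {x : ℂ}
    (hx : x ∈ Complex.slitPlane) {y : ℝ} (hy : 0 < y) {d : ℝ} (hd : d = j * beta S + 2 * m) :
    ∫ w in Ioi (0 : ℝ), wedge S j m w 1 * (w * x + y) ^ (-(d + 2 : ℝ) : ℂ)
      = ((∫ w in Ioi (0 : ℝ), mono (cPlus S) (cMinus S) ((j * beta S + m : ℝ) : ℂ) m w 1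
            * (w * x + y) ^ (-(d + 2 : ℝ) : ℂ))
          - ∫ w in Ioi (0 : ℝ), mono (cMinus S) (cPlus S) ((j * beta S + m : ℝ) : ℂ) m w 1
            * (w * x + y) ^ (-(d + 2 : ℝ) : ℂ)) / (2 * Complex.I) := by
  have hp := exponent_pos hS hj
  have hd' : d = (j * beta S + m) + m := by rw [hd]; ring
  rw [hd', ← integral_sub
    ((hasGrowth_mono (cPlus_mem hS) (by positivity) m).integrableOn_kernel (by positivity) hx hy)
    ((hasGrowth_mono (cMinus_mem hS) (by positivity) m).integrableOn_kernel (by positivity) hx hy),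
    ← integral_div]
  refine setIntegral_congr_fun measurableSet_Ioi fun w hw => ?_
  simp only [wedge_eq hS j m (le_of_lt (mem_Ioi.1 hw)) one_pos]
  ring

/-- The constant in the boundary terms of the functional equation. -/
noncomputable def boundaryConst (S : Matrix (Fin 2) (Fin 2) ℝ) (j m : ℕ) : ℝ :=
  S 0 0 / 2 * (j * beta S) * height S * Real.Gamma (j * beta S + 2 * m)

lemma boundaryConst_pos (hS : S.PosDef) {j : ℕ} (hj : 1 ≤ j) (m : ℕ) :
    0 < boundaryConst S j m := by
  have hp := exponent_pos hS hj
  have h0 := S00_pos hS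
  have h1 := height_pos hS
  have h2 : 0 < Real.Gamma (j * beta S + 2 * m) := Real.Gamma_pos_of_pos (by positivity)
  have h3 : 0 < j * beta S := by linarith
  rw [boundaryConst]
  positivity

/-- Subtract `integral_mono` for the two orders of the roots. The constants at infinity are the same
real number, so with p = jπ/θ + m the boundary terms collapse to (p - m)(c₊ - c₋) times y or x,
where p - m = jπ/θ. -/
lemma gam_mul_wedgeLaplace_aux (hS : S.PosDef) {j : ℕ} (hj : 1 ≤ j) (m : ℕ) {x : ℂ}
    (hx : x ∈ Complex.slitPlane) {y : ℝ} (hy : 0 < y) {d : ℝ} (hd : d = j * beta S + 2 * m) :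
    gam S x y * wedgeLaplace S j m x y
      = kap S * (j * beta S + m : ℝ) * m * (Real.Gamma d
          * (((∫ w in Ioi (0 : ℝ), mono (cPlus S) (cMinus S) ((j * beta S + m : ℝ) - 1) (m - 1) w 1
              * (w * x + y) ^ (-(d : ℝ) : ℂ))
            - ∫ w in Ioi (0 : ℝ), mono (cMinus S) (cPlus S) ((j * beta S + m : ℝ) - 1) (m - 1) w 1
              * (w * x + y) ^ (-(d : ℝ) : ℂ)) / (2 * Complex.I)))
        + boundaryConst S j m * ((y : ℂ) ^ (-(d : ℝ) : ℂ)
          - ((-1) ^ j * modulus S ^ d : ℝ) * x ^ (-(d : ℝ) : ℂ)) := by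
  have hp := exponent_pos hS hj
  have hm : (0 : ℝ) ≤ m := Nat.cast_nonneg m
  have hd0 : 0 < d := by rw [hd]; positivity
  have hd' : d = (j * beta S + m) + m := by rw [hd]; ring
  have h1 := integral_mono (f := cMinus S) (cPlus_mem hS) hx hy (p := j * beta S + m) (by linarith)
    m hd'
  have h2 := integral_mono (f := cPlus S) (cMinus_mem hS) hx hy (p := j * beta S + m) (by linarith)
    m hd'
  have hG : (Real.Gamma (d + 2) : ℂ) = (d + 1) * d * Real.Gamma d := by
    have e1 : d + 2 = (d + 1) + 1 := by ring
    rw [e1, Real.Gamma_add_one (by linarith), Real.Gamma_add_one hd0.ne']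
    push_cast
    ring
  have hpow : ∀ z : ℂ, z ≠ 0 → z ^ (-(d : ℝ) : ℂ) = z ^ (-(d + 1 : ℝ) : ℂ) * z := by
    intro z hz
    have : (-(d : ℝ) : ℂ) = (-(d + 1 : ℝ) : ℂ) + 1 := by push_cast; ring
    rw [this, Complex.cpow_add _ _ hz, Complex.cpow_one]
  rw [cPlus_cpow_mul_cMinus_pow hS, ← hd] at h1
  rw [cMinus_cpow_mul_cPlus_pow hS, ← hd] at h2
  rw [wedgeLaplace, lineLaplace, ← hd, integral_wedge hS hj m hx hy hd, hG, gam_eq hS,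
    hpow x (Complex.slitPlane_ne_zero hx), hpow y (by exact_mod_cast hy.ne'), boundaryConst, ← hd]
  generalize (∫ w in Ioi (0 : ℝ), mono (cPlus S) (cMinus S) ((j * beta S + m : ℝ) : ℂ) m w 1
            * (w * x + y) ^ (-(d + 2 : ℝ) : ℂ)) = A at *
  generalize (∫ w in Ioi (0 : ℝ), mono (cMinus S) (cPlus S) ((j * beta S + m : ℝ) : ℂ) m w 1
            * (w * x + y) ^ (-(d + 2 : ℝ) : ℂ)) = A' at *
  generalize (∫ w in Ioi (0 : ℝ), mono (cPlus S) (cMinus S) ((j * beta S + m : ℝ) - 1) (m - 1) w 1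
              * (w * x + y) ^ (-(d : ℝ) : ℂ)) = B at *
  generalize (∫ w in Ioi (0 : ℝ), mono (cMinus S) (cPlus S) ((j * beta S + m : ℝ) - 1) (m - 1) w 1
              * (w * x + y) ^ (-(d : ℝ) : ℂ)) = B' at *
  generalize x ^ (-(d + 1 : ℝ) : ℂ) = X at *
  generalize (y : ℂ) ^ (-(d + 1 : ℝ) : ℂ) = Y at *
  generalize (((-1) ^ j * modulus S ^ d : ℝ) : ℂ) = K at *
  have hD := cPlus_sub_cMinus (S := S)
  have hk := mul_sq_cPlus_sub_cMinus (S := S)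
  have hI : Complex.I ≠ 0 := Complex.I_ne_zero
  have hDI : (height S : ℂ) = (cPlus S - cMinus S) / (2 * Complex.I) := by
    rw [hD]; field_simp
  rw [← neg_eq_iff_eq_neg] at hk
  push_cast at h1 h2 ⊢
  rw [hDI, ← hk]
  field_simp
  linear_combination ((S 0 0 : ℂ) * Real.Gamma d) * (h1 - h2)

end WedgeLaplace

/-! ### Sums of wedge functions and their lifts -/

section WedgeSum

variable {S : Matrix (Fin 2) (Fin 2) ℝ}

lemma gam_mul_wedgeLaplace_zero (hS : S.PosDef) {j : ℕ} (hj : 1 ≤ j) {x : ℂ}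
    (hx : x ∈ Complex.slitPlane) {y : ℝ} (hy : 0 < y) {d : ℝ} (hd : d = j * beta S) :
    gam S x y * wedgeLaplace S j 0 x y
      = boundaryConst S j 0 * ((y : ℂ) ^ (-(d : ℝ) : ℂ)
          - ((-1) ^ j * modulus S ^ d : ℝ) * x ^ (-(d : ℝ) : ℂ)) := by
  rw [gam_mul_wedgeLaplace_aux hS hj 0 hx hy (d := d) (by rw [hd]; simp)]
  simp

lemma gam_mul_wedgeLaplace_succ (hS : S.PosDef) {j : ℕ} (hj : 1 ≤ j) (m : ℕ) {x : ℂ}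
    (hx : x ∈ Complex.slitPlane) {y : ℝ} (hy : 0 < y) {d : ℝ} (hd : d = j * beta S + 2 * m) :
    gam S x y * wedgeLaplace S j (m + 1) x y
      = ((kap S * (j * beta S + (m + 1 : ℕ)) * (m + 1 : ℕ) : ℝ) : ℂ) * wedgeLaplace S j m x y
        + boundaryConst S j (m + 1) * ((y : ℂ) ^ (-(d + 2 : ℝ) : ℂ)
          - ((-1) ^ j * modulus S ^ (d + 2) : ℝ) * x ^ (-(d + 2 : ℝ) : ℂ)) := by
  rw [gam_mul_wedgeLaplace_aux hS hj (m + 1) hx hy (d := d + 2) (by rw [hd]; push_cast; ring),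
    wedgeLaplace, lineLaplace, ← hd, integral_wedge hS hj m hx hy hd]
  have : ((j * beta S + (m + 1 : ℕ) : ℝ) : ℂ) - 1 = ((j * beta S + m : ℝ) : ℂ) := by
    push_cast; ring
  rw [this, Nat.add_sub_cancel]
  push_cast
  ring

/-- The harmonic functions `wedge S j 0` produce the functions
`(x^(-jπ/θ) - (c₊ y)^(-jπ/θ)) / γ(x, y)`. -/
lemma exists_gam_mul_eq (hS : S.PosDef) {j : ℕ} (hj : 1 ≤ j) {d : ℝ} (hd : d = j * beta S) :
    ∃ r : ℝ, ∀ x ∈ Complex.slitPlane, ∀ y : ℝ, 0 < y →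
      gam S x y * (r * wedgeLaplace S j 0 x y)
        = x ^ (-(d : ℝ) : ℂ) - (cPlus S * y) ^ (-(d : ℝ) : ℂ) := by
  have hC := (boundaryConst_pos hS hj 0).ne'
  have hc := Real.rpow_pos_of_pos (modulus_pos hS) d
  -- The factor makes the coefficient of x^(-d) equal to 1. The y-term then matches because dθ = jπ
  -- makes c₊^(-d) the real number (-1)^j c^(-d), with c the modulus of c₊.
  refine ⟨-((-1) ^ j * (modulus S ^ d)⁻¹ * (boundaryConst S j 0)⁻¹), fun x hx y hy => ?_⟩
  have h1 : cPlus S ^ (-(d : ℝ) : ℂ) = ((-1) ^ j * (modulus S ^ d)⁻¹ : ℝ) := by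
    have h2 : theta S * -d = -(j * Real.pi) := by rw [hd, ← beta_mul_theta hS]; ring
    rw [← Complex.ofReal_neg, cPlus_cpow hS, h2, exp_neg_natCast_pi', Real.rpow_neg (modulus_pos hS).le]
    push_cast
    ring
  have hs : ((-1 : ℂ) ^ j) * (-1) ^ j = 1 := by rw [← mul_pow]; norm_num
  rw [mul_left_comm, gam_mul_wedgeLaplace_zero hS hj hx hy hd, cpow_mul_ofReal (cPlus_ne_zero hS) hy,
    h1]
  have hC' : (boundaryConst S j 0 : ℂ) ≠ 0 := by exact_mod_cast hC
  have hc' : ((modulus S ^ d : ℝ) : ℂ) ≠ 0 := by exact_mod_cast hc.ne'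
  push_cast
  field_simp
  linear_combination (((modulus S ^ d : ℝ) : ℂ) * x ^ (-(d : ℂ))) * hs

/-- Linear combinations, with coefficients in `K`, of the functions `wedge S j m` of degree `d`,
together with their Laplace transforms. -/
inductive IsWedgeSum (S : Matrix (Fin 2) (Fin 2) ℝ) (K : Submodule ℝ ℂ) (d : ℝ) :
    (ℝ → ℝ → ℂ) → (ℂ → ℝ → ℂ) → Prop
  | zero : IsWedgeSum S K d (fun _ _ => 0) (fun _ _ => 0)
  | add {h : ℝ → ℝ → ℂ} {G : ℂ → ℝ → ℂ} (j m : ℕ) (c : ℂ) (H : IsWedgeSum S K d h G) (hj : 1 ≤ j)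
      (hd : d = j * beta S + 2 * m) (hc : c ∈ K) :
      IsWedgeSum S K d (fun u v => h u v + c * wedge S j m u v)
        (fun x y => G x y + c * wedgeLaplace S j m x y)

namespace IsWedgeSum

variable {K : Submodule ℝ ℂ} {d : ℝ} {h : ℝ → ℝ → ℂ} {G : ℂ → ℝ → ℂ}

lemma contDiffOn (hS : S.PosDef) (H : IsWedgeSum S K d h G) :
    ContDiffOn ℝ ∞ (fun p : ℝ × ℝ => h p.1 p.2) quadrant := by
  induction H with
  | zero => exact contDiffOn_const
  | add j m c _ _ _ _ ih => exact ih.add (contDiffOn_const.mul (contDiffOn_wedge hS j m))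

lemma continuousOn (hS : S.PosDef) (H : IsWedgeSum S K d h G) :
    ContinuousOn (fun p : ℝ × ℝ => h p.1 p.2) (Ici 0 ×ˢ Ici 0) := by
  induction H with
  | zero => exact continuousOn_const
  | add j m c _ hj _ _ ih => exact ih.add (continuousOn_const.mul (continuousOn_wedge hS hj m))

lemma zero_left (H : IsWedgeSum S K d h G) {v : ℝ} (hv : 0 ≤ v) : h 0 v = 0 := by
  induction H with
  | zero => rfl
  | add j m c _ _ _ _ ih => simp [ih, wedge_zero_left j m hv]

lemma zero_right (hS : S.PosDef) (H : IsWedgeSum S K d h G) {u : ℝ} (hu : 0 ≤ u) : h u 0 = 0 := by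
  induction H with
  | zero => rfl
  | add j m c _ hj _ _ ih => simp [ih, wedge_zero_right hS hj m hu]

/-- Wedge functions are real valued, so only the coefficients matter. With K the real line in ℂ this
gives the reality of the polyharmonic functions. -/
lemma apply_mem (H : IsWedgeSum S K d h G) (u v : ℝ) : h u v ∈ K := by
  induction H with
  | zero => exact K.zero_mem
  | add j m c _ _ _ hc ih =>
    refine K.add_mem ih ?_
    rw [wedge, mul_comm, ← Complex.real_smul]
    exact K.smul_mem _ hc

lemma isLaplaceTransform (hS : S.PosDef) (H : IsWedgeSum S K d h G) : IsLaplaceTransform h G := by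
  induction H with
  | zero => exact fun x y _ _ => by simp
  | add j m c _ hj _ _ ih =>
    intro x y hx hy
    have hp := exponent_pos hS hj
    obtain ⟨h1, h2⟩ := ih x y hx hy
    obtain ⟨h3, h4⟩ := (isHomogeneousOfDegree_wedge hS hj m).isLaplaceTransform
      (by positivity) x y hx hy
    have e : ∀ (p : ℝ × ℝ) (A B : ℂ), Complex.exp (-(p.1 * x) - p.2 * y) * (A + c * B)
        = Complex.exp (-(p.1 * x) - p.2 * y) * A + c * (Complex.exp (-(p.1 * x) - p.2 * y) * B) :=
      fun p A B => by ring
    simp only [e]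
    refine ⟨h1.add (h3.const_mul c), ?_⟩
    rw [integral_add h1 (h3.const_mul c), integral_const_mul, ← h2, ← h4, wedgeLaplace]

lemma differentiableOn (hS : S.PosDef) (H : IsWedgeSum S K d h G) {y : ℝ} (hy : 0 < y) :
    DifferentiableOn ℂ (fun x => G x y) Complex.slitPlane := by
  induction H with
  | zero => exact differentiableOn_const 0
  | add j m c _ hj _ _ ih =>
    have hp := exponent_pos hS hj
    exact ih.add (((isHomogeneousOfDegree_wedge hS hj m).hasGrowth.differentiableOn_lineLaplace
      (by positivity) hy).const_mul c)

lemma map_smul (H : IsWedgeSum S K d h G) {x : ℂ} (hx : x ∈ Complex.slitPlane) {y : ℝ}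
    (hy : 0 < y) {t : ℝ} (ht : 0 < t) :
    G (t * x) (t * y) = (t : ℂ) ^ (-(d + 2 : ℝ) : ℂ) * G x y := by
  induction H with
  | zero => simp
  | add j m c _ _ hd _ ih =>
    beta_reduce
    rw [ih, wedgeLaplace, lineLaplace_smul hx hy ht, ← hd]
    ring

/-- Every wedge sum is the Laplacian of a wedge sum, and the Laplace transforms satisfy the
functional equation. -/
lemma exists_lift (hS : S.PosDef) (H : IsWedgeSum S K d h G) :
    ∃ (h' : ℝ → ℝ → ℂ) (G' : ℂ → ℝ → ℂ) (A B : ℂ), IsWedgeSum S K (d + 2) h' G' ∧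
      HasLap S h' h ∧ A ∈ K ∧ ∀ x ∈ Complex.slitPlane, ∀ y : ℝ, 0 < y →
        gam S x y * G' x y = G x y - A * x ^ (-(d + 2 : ℝ) : ℂ)
          - B * (y : ℂ) ^ (-(d + 2 : ℝ) : ℂ) := by
  induction H with
  | zero =>
    exact ⟨_, _, 0, 0, IsWedgeSum.zero, hasLap_zero, K.zero_mem, fun _ _ _ _ => by simp⟩
  | @add h G j m c _ hj hd hc ih =>
    obtain ⟨h', G', A, B, H', hlap, hA, hG⟩ := ih
    -- The factor in Δ (`wedge S j (m + 1)`) = r `wedge S j m`. Dividing by it lifts the term by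
    -- raising m and keeping j.
    set r : ℝ := kap S * (j * beta S + (m + 1 : ℕ)) * (m + 1 : ℕ) with hr
    have hr0 : r ≠ 0 := by
      have := exponent_pos hS hj
      have := kap_pos hS
      positivity
    have hr0' : (r : ℂ) ≠ 0 := by exact_mod_cast hr0
    have hmem : ∀ s : ℝ, (s : ℂ) * c ∈ K := fun s => by
      rw [← Complex.real_smul]; exact K.smul_mem s hc
    -- A gathers the boundary terms in x and must stay in K, being the candidate for the next
    -- constant a_n; B need not.
    refine ⟨_, _, A + ((r⁻¹ * boundaryConst S j (m + 1) * ((-1) ^ j * modulus S ^ (d + 2)) : ℝ) : ℂ)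
      * c, B - (r⁻¹ : ℝ) * c * boundaryConst S j (m + 1),
      H'.add j (m + 1) ((r⁻¹ : ℝ) * c) hj (by rw [hd]; push_cast; ring) (hmem _), ?_,
      K.add_mem hA (hmem _), fun x hx y hy => ?_⟩
    · refine (hlap.add_const_mul (hasLap_wedge_succ hS j m) ((r⁻¹ : ℝ) * c)).congr
        (fun _ _ _ _ => rfl) fun u v _ _ => ?_
      rw [← hr]
      push_cast
      field_simp
    · have h1 := gam_mul_wedgeLaplace_succ hS hj m hx hy hd
      rw [← hr] at h1
      rw [mul_add, hG x hx y hy, mul_left_comm, h1]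
      push_cast
      field_simp
      ring

end IsWedgeSum

end WedgeSum

/-! ### Removing the singularities of the quotients -/

section Quotient

variable {S : Matrix (Fin 2) (Fin 2) ℝ}

lemma eventually_gam_ne_zero (hS : S.PosDef) (x : ℂ) (y : ℝ) :
    ∀ᶠ z in 𝓝[≠] x, gam S z y ≠ 0 := by
  have hfin : ({cPlus S * y, cMinus S * y} \ {x} : Set ℂ).Finite := (Set.toFinite _).sdiff
  have h1 : ∀ᶠ z in 𝓝[≠] x, z ∈ ({cPlus S * y, cMinus S * y} \ {x} : Set ℂ)ᶜ :=
    nhdsWithin_le_nhds (hfin.isClosed.isOpen_compl.mem_nhds (by simp))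
  filter_upwards [h1, self_mem_nhdsWithin] with z hz hzx h0
  refine hz ⟨?_, hzx⟩
  simpa using (gam_eq_zero_iff hS z y).1 h0

/-- The zeros of γ(·, y) are isolated, so a continuous solution F of γ F = N is the quotient off the
zeros and its limit at them. -/
lemma quotGam_eq (hS : S.PosDef) {N : ℂ → ℝ → ℂ} {y : ℝ} {F : ℂ → ℂ}
    (hF : ContinuousOn F Complex.slitPlane)
    (hN : ∀ z ∈ Complex.slitPlane, gam S z y * F z = N z y) {x : ℂ} (hx : x ∈ Complex.slitPlane) :
    quotGam S N x y = F x := by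
  rw [quotGam]
  split_ifs with h0
  · refine Tendsto.limUnder_eq ?_
    have h1 : Tendsto F (𝓝[≠] x) (𝓝 (F x)) :=
      (hF.continuousAt (Complex.isOpen_slitPlane.mem_nhds hx)).tendsto.mono_left nhdsWithin_le_nhds
    refine h1.congr' ?_
    filter_upwards [eventually_gam_ne_zero hS x y,
      nhdsWithin_le_nhds (Complex.isOpen_slitPlane.mem_nhds hx)] with z hz hzs
    rw [← hN z hzs, mul_div_cancel_left₀ _ hz]
  · rw [← hN x hx, mul_div_cancel_left₀ _ h0]

lemma eqOn_of_gam_mul_eq (hS : S.PosDef) {y : ℝ} {F F' : ℂ → ℂ}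
    (hF : ContinuousOn F Complex.slitPlane) (hF' : ContinuousOn F' Complex.slitPlane)
    (h : ∀ z ∈ Complex.slitPlane, gam S z y * F z = gam S z y * F' z) :
    EqOn F F' Complex.slitPlane := fun x hx => by
  rw [← quotGam_eq hS (N := fun z y => gam S z y * F' z) hF h hx]
  exact quotGam_eq hS hF' (fun z _ => rfl) hx

end Quotient

/-! ### The chain of polyharmonic functions -/

section Chain

variable {S : Matrix (Fin 2) (Fin 2) ℝ} {K : Submodule ℝ ℂ} {k : ℕ} {a : ℕ → ℂ}

lemma omegaHat_pow (k : ℕ) (x : ℂ) :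
    omegaHat S x ^ k = x ^ (-(k * beta S : ℝ) : ℂ) := by
  rw [omegaHat, one_div, inv_pow, ← Complex.cpow_nat_mul, Complex.cpow_neg]
  push_cast
  rfl

lemma ansatz_eq (k n : ℕ) (α x : ℂ) :
    ansatz S k n α x = α * x ^ (-(k * beta S + 2 * n : ℝ) : ℂ) := by
  rw [ansatz, Complex.cpow_neg, div_eq_mul_inv]

lemma gam_cPlus (hS : S.PosDef) (y : ℂ) : gam S (cPlus S * y) y = 0 :=
  (gam_eq_zero_iff hS _ _).2 (Or.inl rfl)

lemma gam_cMinus (hS : S.PosDef) (y : ℂ) : gam S (cMinus S * y) y = 0 :=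
  (gam_eq_zero_iff hS _ _).2 (Or.inr rfl)

/-- The moduli agree, so the hypothesis reads e^(-isθ) = e^(isθ), that is sθ ∈ πℤ. This is the only
case in which the decoupling condition does not determine the constant. -/
lemma exists_eq_mul_beta (hS : S.PosDef) {s : ℝ} (hs : 0 < s)
    (h : cPlus S ^ (-(s : ℝ) : ℂ) = cMinus S ^ (-(s : ℝ) : ℂ)) :
    ∃ j : ℕ, 1 ≤ j ∧ s = j * beta S := by
  have hc : ((modulus S ^ (-s) : ℝ) : ℂ) ≠ 0 := by
    exact_mod_cast (Real.rpow_pos_of_pos (modulus_pos hS) _).ne'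
  rw [← Complex.ofReal_neg, cPlus_cpow hS, cMinus_cpow hS, mul_right_inj' hc,
    Complex.exp_eq_exp_iff_exists_int] at h
  obtain ⟨n, hn⟩ := h
  have hn' : theta S * s = -n * Real.pi := by
    have := congrArg Complex.im hn
    simp at this
    linarith
  have h1 : s = -n * beta S := by
    have := (theta_pos hS).ne'
    rw [beta]
    field_simp
    linarith
  have hn0 : 0 < -n := by
    by_contra hcon
    have : ((-n : ℤ) : ℝ) ≤ 0 := by exact_mod_cast not_lt.1 hcon
    push_cast at this
    nlinarith [one_lt_beta hS]
  obtain ⟨j, hj⟩ := Int.eq_ofNat_of_zero_le hn0.le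
  refine ⟨j, by omega, ?_⟩
  rw [h1]
  congr 1
  exact_mod_cast congrArg (fun z : ℤ => (z : ℝ)) hj

lemma exists_isWedgeSum_one (hS : S.PosDef) (hK : (1 : ℂ) ∈ K) (hk : 1 ≤ k) :
    ∃ (h : ℝ → ℝ → ℂ) (G : ℂ → ℝ → ℂ), IsWedgeSum S K (k * beta S + 2 * (0 : ℕ)) h G ∧
      HasLap S h (fun _ _ => 0) ∧
      ∀ x ∈ Complex.slitPlane, ∀ y : ℝ, 0 < y → Lh S k a 1 x y = G x y := by
  obtain ⟨r, hr⟩ := exists_gam_mul_eq hS hk rfl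
  have hrK : (r : ℂ) ∈ K := by
    have := K.smul_mem r hK
    rwa [Complex.real_smul, mul_one] at this
  have H := IsWedgeSum.zero.add (S := S) (K := K) (d := k * beta S + 2 * (0 : ℕ)) k 0 r hk rfl hrK
  refine ⟨_, _, H, ?_, fun x hx y hy => ?_⟩
  · refine ((hasLap_zero (S := S)).add_const_mul (hasLap_wedge_zero hS k) r).congr
      (fun _ _ _ _ => rfl) fun u v _ _ => by simp
  · refine quotGam_eq hS (H.differentiableOn hS hy).continuousOn (fun z hz => ?_) hx
    rw [omegaHat_pow, omegaHat_pow, ← hr z hz y hy, zero_add]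

/-- Evaluate the functional equation of the lift at c₊ y and c₋ y: γ vanishes, and the term in y
cancels in the difference. -/
lemma exists_isDecoupling (hS : S.PosDef) {n : ℕ} {h : ℝ → ℝ → ℂ} {G : ℂ → ℝ → ℂ}
    (H : IsWedgeSum S K (k * beta S + 2 * n) h G)
    (hL : ∀ x ∈ Complex.slitPlane, ∀ y : ℝ, 0 < y → Lh S k a (n + 1) x y = G x y) :
    ∃ α ∈ K, IsDecoupling S (ansatz S k (n + 1) α) (Lh S k a (n + 1)) := by
  obtain ⟨h', G', A, B, -, -, hA, hG⟩ := H.exists_lift hS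
  refine ⟨A, hA, fun y hy => ?_⟩
  have h1 := hG _ (cPlus_mul_mem hS hy) y hy
  have h2 := hG _ (cMinus_mul_mem hS hy) y hy
  rw [gam_cPlus hS, zero_mul] at h1
  rw [gam_cMinus hS, zero_mul] at h2
  have e : k * beta S + 2 * ((n + 1 : ℕ) : ℝ) = k * beta S + 2 * n + 2 := by push_cast; ring
  rw [hL _ (cPlus_mul_mem hS hy) y hy, hL _ (cMinus_mul_mem hS hy) y hy, ansatz_eq, ansatz_eq, e]
  linear_combination h1 - h2

lemma exists_isWedgeSum_succ (hS : S.PosDef) {n : ℕ} {h : ℝ → ℝ → ℂ} {G : ℂ → ℝ → ℂ}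
    (H : IsWedgeSum S K (k * beta S + 2 * n) h G)
    (hL : ∀ x ∈ Complex.slitPlane, ∀ y : ℝ, 0 < y → Lh S k a (n + 1) x y = G x y)
    (ha : a (n + 1) ∈ K)
    (hdec : IsDecoupling S (ansatz S k (n + 1) (a (n + 1))) (Lh S k a (n + 1))) :
    ∃ (h' : ℝ → ℝ → ℂ) (G' : ℂ → ℝ → ℂ), IsWedgeSum S K (k * beta S + 2 * (n + 1 : ℕ)) h' G' ∧
      HasLap S h' h ∧
      ∀ x ∈ Complex.slitPlane, ∀ y : ℝ, 0 < y → Lh S k a (n + 2) x y = G' x y := by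
  obtain ⟨h', G', A, B, H', hlap, hA, hG⟩ := H.exists_lift hS
  have e : k * beta S + 2 * (n : ℝ) + 2 = k * beta S + 2 * ((n + 1 : ℕ) : ℝ) := by push_cast; ring
  rw [e] at H' hG
  set d : ℝ := k * beta S + 2 * ((n + 1 : ℕ) : ℝ) with hd
  have hd0 : 0 < d := by have := one_lt_beta hS; positivity
  have hplus : ∀ y : ℝ, 0 < y → G (cPlus S * y) y
      = A * (cPlus S * y) ^ (-(d : ℝ) : ℂ) + B * (y : ℂ) ^ (-(d : ℝ) : ℂ) := fun y hy => by
    have h1 := hG _ (cPlus_mul_mem hS hy) y hy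
    rw [gam_cPlus hS, zero_mul] at h1
    linear_combination -h1
  -- the correction that turns `G'` into the next transform
  obtain ⟨h'', G'', H'', hlap'', hG''⟩ : ∃ (h'' : ℝ → ℝ → ℂ) (G'' : ℂ → ℝ → ℂ),
      IsWedgeSum S K d h'' G'' ∧ HasLap S h'' h ∧
      ∀ x ∈ Complex.slitPlane, ∀ y : ℝ, 0 < y → gam S x y * G'' x y = gam S x y * G' x y
        + (A - a (n + 1)) * (x ^ (-(d : ℝ) : ℂ) - (cPlus S * y) ^ (-(d : ℝ) : ℂ)) := by
    by_cases hAa : A = a (n + 1)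
    · exact ⟨h', G', H', hlap, fun x _ y _ => by rw [hAa]; ring⟩
    -- Both A and a_(n+1) decouple, so c₊^(-d) = c₋^(-d) and d = jπ/θ. A harmonic `wedge S j 0` of
    -- this degree changes the coefficient of x^(-d) without changing the Laplacian.
    · have h1 := hdec 1 one_pos
      have hp := cPlus_mul_mem hS one_pos
      have hm := cMinus_mul_mem hS one_pos
      have h2 := hG _ hm 1 one_pos
      rw [gam_cMinus hS, zero_mul] at h2
      rw [hL _ hp 1 one_pos, hL _ hm 1 one_pos, hplus 1 one_pos, ansatz_eq, ansatz_eq, ← hd] at h1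
      have h3 : (A - a (n + 1)) * (cPlus S ^ (-(d : ℝ) : ℂ) - cMinus S ^ (-(d : ℝ) : ℂ)) = 0 := by
        simp only [Complex.ofReal_one, mul_one] at h1 h2 ⊢
        linear_combination -h1 - h2
      obtain ⟨j, hj, hdj⟩ := exists_eq_mul_beta hS hd0
        (sub_eq_zero.1 ((mul_eq_zero.1 h3).resolve_left (sub_ne_zero.2 hAa)))
      obtain ⟨r, hr⟩ := exists_gam_mul_eq hS hj hdj
      have hmem : (r : ℂ) * (A - a (n + 1)) ∈ K := by
        rw [← Complex.real_smul]
        exact K.smul_mem r (K.sub_mem hA ha)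
      refine ⟨_, _, H'.add j 0 (r * (A - a (n + 1))) hj (by rw [hdj]; simp) hmem, ?_,
        fun x hx y hy => ?_⟩
      · exact (hlap.add_const_mul (hasLap_wedge_zero hS j) _).congr (fun _ _ _ _ => rfl)
          fun u v _ _ => by simp
      · linear_combination (A - a (n + 1)) * hr x hx y hy
  refine ⟨h'', G'', H'', hlap'', fun x hx y hy => ?_⟩
  refine quotGam_eq hS (H''.differentiableOn hS hy).continuousOn (fun z hz => ?_) hx
  rw [hL z hz y hy, hL _ (cPlus_mul_mem hS hy) y hy, hplus y hy, ansatz_eq, ansatz_eq, ← hd,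
    hG'' z hz y hy, hG z hz y hy]
  ring

/-- The construction up to a given step. -/
lemma exists_isWedgeSum (hS : S.PosDef) (hK : (1 : ℂ) ∈ K) (hk : 1 ≤ k) (n : ℕ)
    (ha : ∀ j, 1 ≤ j → j < n + 1 → a j ∈ K)
    (hdec : ∀ j, 1 ≤ j → j < n + 1 → IsDecoupling S (ansatz S k j (a j)) (Lh S k a j)) :
    ∃ (h : ℝ → ℝ → ℂ) (G : ℂ → ℝ → ℂ), IsWedgeSum S K (k * beta S + 2 * n) h G ∧
      ∀ x ∈ Complex.slitPlane, ∀ y : ℝ, 0 < y → Lh S k a (n + 1) x y = G x y := by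
  induction n with
  | zero =>
    obtain ⟨h, G, H, -, hL⟩ := exists_isWedgeSum_one hS hK hk (a := a)
    exact ⟨h, G, H, hL⟩
  | succ n ih =>
    obtain ⟨h, G, H, hL⟩ := ih (fun j h1 h2 => ha j h1 (by omega))
      (fun j h1 h2 => hdec j h1 (by omega))
    obtain ⟨h', G', H', -, hL'⟩ := exists_isWedgeSum_succ hS H hL (ha _ (by omega) (by omega))
      (hdec _ (by omega) (by omega))
    exact ⟨h', G', H', hL'⟩

/-- A chain of functions with `Δ h_(n+1) = h_n` whose Laplace transforms are the functions
`Lh S k a (n + 1)`. -/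
lemma exists_chain (hS : S.PosDef) (hK : (1 : ℂ) ∈ K) (hk : 1 ≤ k) (ha : ∀ j, 1 ≤ j → a j ∈ K)
    (hdec : ∀ j, 1 ≤ j → IsDecoupling S (ansatz S k j (a j)) (Lh S k a j)) :
    ∃ h : ℕ → ℝ → ℝ → ℂ, HasLap S (h 0) (fun _ _ => 0) ∧ (∀ n : ℕ, HasLap S (h (n + 1)) (h n)) ∧
      ∀ n : ℕ, ∃ G : ℂ → ℝ → ℂ, IsWedgeSum S K (k * beta S + 2 * n) (h n) G ∧
        ∀ x ∈ Complex.slitPlane, ∀ y : ℝ, 0 < y → Lh S k a (n + 1) x y = G x y := by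
  -- Consecutive functions must be linked by Δ, so a lift is chosen above every admissible function
  -- and the choice is iterated from the first one.
  let P : ℕ → (ℝ → ℝ → ℂ) → Prop := fun n h => ∃ G : ℂ → ℝ → ℂ,
    IsWedgeSum S K (k * beta S + 2 * n) h G ∧
      ∀ x ∈ Complex.slitPlane, ∀ y : ℝ, 0 < y → Lh S k a (n + 1) x y = G x y
  have h0 : ∃ h, P 0 h ∧ HasLap S h (fun _ _ => 0) := by
    obtain ⟨h, G, H, hlap, hL⟩ := exists_isWedgeSum_one hS hK hk (a := a)
    exact ⟨h, ⟨G, H, hL⟩, hlap⟩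
  have hstep : ∀ (n : ℕ) (p : {h // P n h}), ∃ q : {h // P (n + 1) h}, HasLap S q.1 p.1 := by
    rintro n ⟨h, G, H, hL⟩
    obtain ⟨h', G', H', hlap, hL'⟩ := exists_isWedgeSum_succ hS H hL (ha _ (by omega))
      (hdec _ (by omega))
    exact ⟨⟨h', G', H', hL'⟩, hlap⟩
  obtain ⟨i, hi, hi0⟩ := h0
  choose next hnext using hstep
  let s : ∀ n, {h // P n h} := fun n => Nat.rec (motive := fun n => {h // P n h}) ⟨i, hi⟩ next n
  exact ⟨fun n => (s n).1, hi0, fun n => hnext n (s n), fun n => (s n).2⟩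

end Chain

/-! ### The form of the transforms -/

section Form

variable {S : Matrix (Fin 2) (Fin 2) ℝ} {k : ℕ} {a : ℕ → ℂ}

lemma differentiableOn_Lh_and_map_smul (hS : S.PosDef) (hk : 1 ≤ k)
    (hdec : ∀ j, 1 ≤ j → IsDecoupling S (ansatz S k j (a j)) (Lh S k a j)) (n : ℕ) :
    (∀ y : ℝ, 0 < y → DifferentiableOn ℂ (fun x => Lh S k a n x y) Complex.slitPlane) ∧
    ∀ x ∈ Complex.slitPlane, ∀ y : ℝ, 0 < y → ∀ t : ℝ, 0 < t → Lh S k a n (t * x) (t * y)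
      = (t : ℂ) ^ (-(k * beta S + 2 * n : ℝ) : ℂ) * Lh S k a n x y := by
  rcases n with _ | n
  · exact ⟨fun y _ => differentiableOn_const 0, fun x _ y _ t _ => (mul_zero _).symm⟩
  · obtain ⟨h, G, H, hL⟩ := exists_isWedgeSum (K := ⊤) hS trivial hk n (fun _ _ _ => trivial)
      (fun j h1 _ => hdec j h1)
    refine ⟨fun y hy => (H.differentiableOn hS hy).congr fun x hx => hL x hx y hy,
      fun x hx y hy t ht => ?_⟩
    have htx : (t : ℂ) * x ∈ Complex.slitPlane := by
      rcases hx with h | h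
      · left; rw [Complex.re_ofReal_mul]; positivity
      · right; rw [Complex.im_ofReal_mul]; exact mul_ne_zero ht.ne' h
    have e : k * beta S + 2 * (n : ℝ) + 2 = k * beta S + 2 * ((n + 1 : ℕ) : ℝ) := by
      push_cast; ring
    rw [hL _ htx _ (mul_pos ht hy), hL x hx y hy, H.map_smul hx hy ht, e]

/-- At the zeros of γ both sides vanish, whatever value the quotient is given there. -/
lemma gam_mul_quotGam (hS : S.PosDef) {N : ℂ → ℝ → ℂ} {y : ℝ} (hp : N (cPlus S * y) y = 0)
    (hm : N (cMinus S * y) y = 0) (x : ℂ) : gam S x y * quotGam S N x y = N x y := by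
  rw [quotGam]
  split_ifs with h0
  · rcases (gam_eq_zero_iff hS x y).1 h0 with rfl | rfl
    · rw [h0, hp, zero_mul]
    · rw [h0, hm, zero_mul]
  · rw [mul_div_cancel₀ _ h0]

/-- Apart from L_n and a power of x, the numerator in the recursion depends on y alone, and by
homogeneity this part is a multiple of a power of y. The decoupling condition makes the numerator
vanish at c₋ y too. -/
lemma exists_gam_mul_Lh (hS : S.PosDef) (hk : 1 ≤ k)
    (hdec : ∀ j, 1 ≤ j → IsDecoupling S (ansatz S k j (a j)) (Lh S k a j)) (n : ℕ) :
    ∃ A B : ℂ, ∀ x ∈ Complex.slitPlane, ∀ y : ℝ, 0 < y →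
      gam S x y * Lh S k a (n + 1) x y = Lh S k a n x y
        - A * x ^ (-(k * beta S + 2 * n : ℝ) : ℂ)
        - B * (y : ℂ) ^ (-(k * beta S + 2 * n : ℝ) : ℂ) := by
  rcases n with _ | n
  -- With L_0 = 0 the numerator of L_1 has the general form for A = -1.
  · refine ⟨-1, cPlus S ^ (-(k * beta S : ℝ) : ℂ), fun x hx y hy => ?_⟩
    obtain ⟨r, hr⟩ := exists_gam_mul_eq hS hk rfl
    have h1 := hr _ (cMinus_mul_mem hS hy) y hy
    rw [gam_cMinus hS, zero_mul] at h1
    refine (gam_mul_quotGam hS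
      (N := fun x y => omegaHat S x ^ k - omegaHat S (cPlus S * y) ^ k) (sub_self _)
      (by rw [omegaHat_pow, omegaHat_pow, ← h1]) x).trans ?_
    rw [omegaHat_pow, omegaHat_pow, cpow_mul_ofReal (cPlus_ne_zero hS) hy]
    simp [Lh]
  · have hhom := (differentiableOn_Lh_and_map_smul hS hk hdec (n + 1)).2
    refine ⟨a (n + 1), Lh S k a (n + 1) (cPlus S) 1
      - a (n + 1) * cPlus S ^ (-(k * beta S + 2 * (n + 1 : ℕ) : ℝ) : ℂ), fun x hx y hy => ?_⟩
    have h1 := hhom _ (cPlus_mem hS) 1 one_pos y hy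
    rw [mul_one, mul_comm] at h1
    rw [Lh, gam_mul_quotGam hS (sub_self _)
      (by linear_combination hdec (n + 1) (by omega) y hy), ansatz_eq, ansatz_eq, h1,
      cpow_mul_ofReal (cPlus_ne_zero hS) hy]
    ring

lemma cpow_exponent {x : ℂ} (hx : x ≠ 0) (k n : ℕ) :
    x ^ ((k * beta S + 2 * n : ℝ) : ℂ) = x ^ (2 * n) * (x ^ (beta S : ℂ)) ^ k := by
  rw [← Complex.cpow_nat_mul, ← Complex.cpow_natCast x (2 * n), ← Complex.cpow_add _ _ hx]
  congr 1
  push_cast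
  ring

-- Multiply the recurrence by γ^n x^α y^α, where x^α = x^(2n) (x^(π/θ))^k is a monomial in the
-- allowed variables. The extra factor x² y² in the witness comes from α growing by 2 at each step.
open MvPolynomial in
lemma exists_mvPolynomial (hS : S.PosDef) (hk : 1 ≤ k)
    (hdec : ∀ j, 1 ≤ j → IsDecoupling S (ansatz S k j (a j)) (Lh S k a j)) (n : ℕ) :
    ∃ P : MvPolynomial (Fin 4) ℂ, ∀ x ∈ Complex.slitPlane, ∀ y : ℝ, 0 < y →
      gam S x y ^ n * (Lh S k a n x y * (x ^ ((k * beta S + 2 * n : ℝ) : ℂ)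
        * (y : ℂ) ^ ((k * beta S + 2 * n : ℝ) : ℂ)))
        = eval ![x, (y : ℂ), x ^ (beta S : ℂ), (y : ℂ) ^ (beta S : ℂ)] P := by
  induction n with
  | zero => exact ⟨0, fun x _ y _ => by simp [Lh]⟩
  | succ n ih =>
    obtain ⟨P, hP⟩ := ih
    obtain ⟨A, B, hAB⟩ := exists_gam_mul_Lh hS hk hdec n
    let g : MvPolynomial (Fin 4) ℂ := C (1 / 2) * (C (S 0 0 : ℂ) * X 0 ^ 2
      + 2 * C (S 0 1 : ℂ) * X 0 * X 1 + C (S 1 1 : ℂ) * X 1 ^ 2)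
    refine ⟨(P - g ^ n * (C A * (X 1 ^ (2 * n) * X 3 ^ k) + C B * (X 0 ^ (2 * n) * X 2 ^ k)))
      * (X 0 ^ 2 * X 1 ^ 2), fun x hx y hy => ?_⟩
    have hx0 := Complex.slitPlane_ne_zero hx
    have hy0 : (y : ℂ) ≠ 0 := by exact_mod_cast hy.ne'
    have hg : eval ![x, (y : ℂ), x ^ (beta S : ℂ), (y : ℂ) ^ (beta S : ℂ)] g = gam S x y := by
      simp [g, gam]
    have hrec := hAB x hx y hy
    have hsucc : ∀ z : ℂ, z ≠ 0 → z ^ ((k * beta S + 2 * (n + 1 : ℕ) : ℝ) : ℂ)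
        = z ^ ((k * beta S + 2 * n : ℝ) : ℂ) * z ^ 2 := by
      intro z hz
      rw [cpow_exponent hz, cpow_exponent hz]
      ring
    rw [Complex.cpow_neg, Complex.cpow_neg] at hrec
    have hxa : x ^ ((k * beta S + 2 * n : ℝ) : ℂ) ≠ 0 := by simp [Complex.cpow_eq_zero_iff, hx0]
    have hya : (y : ℂ) ^ ((k * beta S + 2 * n : ℝ) : ℂ) ≠ 0 := by
      simp [Complex.cpow_eq_zero_iff, hy0]
    simp only [map_mul, map_sub, map_add, map_pow, hg, eval_C, eval_X, ← hP x hx y hy, hsucc x hx0,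
      hsucc y hy0]
    simp only [Matrix.cons_val]
    rw [← cpow_exponent hx0, ← cpow_exponent hy0]
    generalize x ^ ((k * beta S + 2 * n : ℝ) : ℂ) = X at *
    generalize (y : ℂ) ^ ((k * beta S + 2 * n : ℝ) : ℂ) = Y at *
    field_simp at hrec
    linear_combination (gam S x y ^ n * x ^ 2 * y ^ 2) * hrec

-- Set y = 1. The numerator r equals γ(z, 1) times a finite value, so it vanishes at the distinct
-- points c₊ and c₋ and is divisible by γ(z, 1). The division lowers the degree by 2, and the factor
-- z² restores it.
open Polynomial in
lemma exists_polynomial (hS : S.PosDef) (hk : 1 ≤ k)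
    (hdec : ∀ j, 1 ≤ j → IsDecoupling S (ansatz S k j (a j)) (Lh S k a j)) {m : ℕ}
    (hm : k * beta S = m) (n : ℕ) :
    ∃ p : ℂ[X], p.natDegree ≤ m + 2 * n ∧ ∀ z ∈ Complex.slitPlane,
      Lh S k a n z 1 * z ^ (m + 2 * n) = p.eval z := by
  induction n with
  | zero => exact ⟨0, by simp, fun z _ => by simp [Lh]⟩
  | succ n ih =>
    obtain ⟨p, hp, hpz⟩ := ih
    obtain ⟨A, B, hAB⟩ := exists_gam_mul_Lh hS hk hdec n
    have hS0 : (S 0 0 : ℂ) ≠ 0 := by exact_mod_cast (S00_pos hS).ne'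
    set r : ℂ[X] := p - C A - C B * X ^ (m + 2 * n) with hr
    have hrz : ∀ z ∈ Complex.slitPlane,
        gam S z (1 : ℝ) * Lh S k a (n + 1) z 1 * z ^ (m + 2 * n) = r.eval z := by
      intro z hz
      have hz0 := Complex.slitPlane_ne_zero hz
      have e : ((k * beta S + 2 * n : ℝ) : ℂ) = ((m + 2 * n : ℕ) : ℂ) := by
        rw [hm]; push_cast; ring
      have h := hAB z hz 1 one_pos
      rw [Complex.cpow_neg, e, Complex.cpow_natCast, Complex.ofReal_one, Complex.one_cpow,
        mul_one] at h
      rw [Complex.ofReal_one, h, hr, eval_sub, eval_sub, eval_mul, eval_C, eval_C, eval_pow, eval_X,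
        ← hpz z hz]
      field_simp
    have hrp : r.IsRoot (cPlus S) := by
      have h := hrz _ (cPlus_mem hS)
      have h0 := gam_cPlus hS (1 : ℝ)
      rw [Complex.ofReal_one, mul_one] at h0
      rw [Complex.ofReal_one, h0, zero_mul, zero_mul] at h
      exact h.symm
    have hrm : r.IsRoot (cMinus S) := by
      have h := hrz _ (cMinus_mem hS)
      have h0 := gam_cMinus hS (1 : ℝ)
      rw [Complex.ofReal_one, mul_one] at h0
      rw [Complex.ofReal_one, h0, zero_mul, zero_mul] at h
      exact h.symm
    obtain ⟨r₁, hr₁⟩ := dvd_iff_isRoot.2 hrp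
    have hr₁m : r₁.IsRoot (cMinus S) := by
      have h : r.eval (cMinus S) = 0 := hrm
      rw [hr₁, eval_mul, eval_sub, eval_X, eval_C] at h
      exact (mul_eq_zero.1 h).resolve_left (sub_ne_zero.2 (cPlus_ne_cMinus hS).symm)
    obtain ⟨t, ht⟩ := dvd_iff_isRoot.2 hr₁m
    have hrdeg : r.natDegree ≤ m + 2 * n := by
      refine (natDegree_sub_le_of_le (natDegree_sub_le_of_le hp (natDegree_C A).le)
        (natDegree_C_mul_X_pow_le B _)).trans ?_
      simp
    refine ⟨C (2 / (S 0 0 : ℂ)) * (X ^ 2 * t), ?_, ?_⟩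
    · refine (natDegree_C_mul_le _ _).trans ?_
      by_cases ht0 : t = 0
      · simp [ht0]
      · have h1 : r.natDegree = 1 + (1 + t.natDegree) := by
          rw [hr₁, ht, natDegree_mul (X_sub_C_ne_zero _) (mul_ne_zero (X_sub_C_ne_zero _) ht0),
            natDegree_mul (X_sub_C_ne_zero _) ht0, natDegree_X_sub_C, natDegree_X_sub_C]
        refine natDegree_mul_le.trans ?_
        rw [natDegree_X_pow]
        omega
    -- The equality is clear after multiplication by γ; continuity removes the factor at its zeros.
    · have hcont := ((differentiableOn_Lh_and_map_smul hS hk hdec (n + 1)).1 1 one_pos).continuousOn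
      refine eqOn_of_gam_mul_eq hS (y := 1) (hcont.mul (by fun_prop)) (by fun_prop) fun z hz => ?_
      have h := hrz z hz
      rw [hr₁, ht, eval_mul, eval_mul, eval_sub, eval_sub, eval_X, eval_C, eval_C] at h
      have hg := gam_eq hS z (1 : ℝ)
      rw [eval_mul, eval_mul, eval_C, eval_pow, eval_X]
      have e : m + 2 * (n + 1) = m + 2 * n + 2 := by ring
      rw [e, pow_add, ← mul_assoc, ← mul_assoc, h, hg]
      rw [Complex.ofReal_one]
      field_simp

-- Homogeneity reduces L_n(x, y) to L_n(x/y, 1), so the polynomial in x/y is homogenized with powers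
-- of y.
open MvPolynomial in
lemma exists_isHomogeneous (hS : S.PosDef) (hk : 1 ≤ k)
    (hdec : ∀ j, 1 ≤ j → IsDecoupling S (ansatz S k j (a j)) (Lh S k a j)) {m : ℕ}
    (hm : k * beta S = m) (n : ℕ) :
    ∃ Q : MvPolynomial (Fin 2) ℂ, Q.IsHomogeneous (m + 2 * n) ∧
      ∀ x ∈ Complex.slitPlane, ∀ y : ℝ, 0 < y →
        Lh S k a n x y * (x ^ ((k * beta S + 2 * n : ℝ) : ℂ)
          * (y : ℂ) ^ ((k * beta S + 2 * n : ℝ) : ℂ)) = eval ![x, (y : ℂ)] Q := by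
  obtain ⟨p, hp, hpz⟩ := exists_polynomial hS hk hdec hm n
  refine ⟨∑ i ∈ Finset.range (m + 2 * n + 1), C (p.coeff i) * (X 0 ^ i * X 1 ^ (m + 2 * n - i)),
    IsHomogeneous.sum _ _ _ fun i hi => ?_, fun x hx y hy => ?_⟩
  · have h := (isHomogeneous_C (Fin 2) (p.coeff i)).mul
      ((isHomogeneous_X_pow (R := ℂ) (0 : Fin 2) i).mul
        (isHomogeneous_X_pow (R := ℂ) (1 : Fin 2) (m + 2 * n - i)))
    have hi' : 0 + (i + (m + 2 * n - i)) = m + 2 * n := by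
      have := Finset.mem_range.1 hi
      omega
    rwa [hi'] at h
  · have hy0 : (y : ℂ) ≠ 0 := by exact_mod_cast hy.ne'
    have hz : x / y ∈ Complex.slitPlane := by
      rcases hx with h | h
      · left; rw [Complex.div_ofReal_re]; positivity
      · right; rw [Complex.div_ofReal_im]; exact div_ne_zero h hy.ne'
    have h := (differentiableOn_Lh_and_map_smul hS hk hdec n).2 (x / y) hz 1 one_pos y hy
    have e : ((k * beta S + 2 * n : ℝ) : ℂ) = ((m + 2 * n : ℕ) : ℂ) := by
      rw [hm]; push_cast; ring
    rw [mul_div_cancel₀ _ hy0, mul_one, Complex.cpow_neg, e, Complex.cpow_natCast] at h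
    rw [e, Complex.cpow_natCast, Complex.cpow_natCast, h, map_sum]
    have h2 : ∀ i ∈ Finset.range (m + 2 * n + 1),
        eval ![x, (y : ℂ)] (C (p.coeff i) * (X 0 ^ i * X 1 ^ (m + 2 * n - i)))
          = p.coeff i * (x / y) ^ i * (y : ℂ) ^ (m + 2 * n) := by
      intro i hi
      have hi' : i ≤ m + 2 * n := Nat.lt_succ_iff.1 (Finset.mem_range.1 hi)
      simp only [map_mul, map_pow, eval_C, eval_X, Matrix.cons_val_zero, Matrix.cons_val_one]
      rw [← pow_sub_mul_pow (y : ℂ) hi', div_pow]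
      field_simp
    rw [Finset.sum_congr rfl h2, ← Finset.sum_mul,
      ← Polynomial.eval_eq_sum_range' (Nat.lt_succ_of_le hp), ← hpz _ hz, div_pow]
    field_simp

end Form

/-! ### Polyharmonicity -/

/-- Δ h_(n+1) = h_n is known only on the open quadrant. Since Δ is local, it can still be iterated
there. -/
lemma iterate_lap_eq_zero {S : Matrix (Fin 2) (Fin 2) ℝ} {h : ℕ → ℝ → ℝ → ℂ}
    (h0 : ∀ u v : ℝ, h 0 u v = 0) (hlap : ∀ n, HasLap S (h (n + 1)) (h n)) (n : ℕ) :
    ∀ u v : ℝ, 0 < u → 0 < v → ((lap S)^[n] (h n)) u v = 0 := by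
  induction n with
  | zero => exact fun u v _ _ => h0 u v
  | succ n ih =>
    intro u v hu hv
    rw [Function.iterate_succ_apply,
      iterate_lap_congr n (fun u v hu hv => (hlap n).lap_eq hu hv) u v hu hv]
    exact ih u v hu hv

end QuadrantBM

theorem mainTheorem5 (S : Matrix (Fin 2) (Fin 2) ℝ) (hS : S.PosDef) (k : ℕ) (hk : 1 ≤ k) :
    -- the inductive construction never stops: as long as the previous constants give
    -- decoupling functions, there is a next one of the required form
    (∀ (a : ℕ → ℂ) (n : ℕ), 1 ≤ n →
      (∀ j : ℕ, 1 ≤ j → j < n →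
        QuadrantBM.IsDecoupling S (QuadrantBM.ansatz S k j (a j)) (QuadrantBM.Lh S k a j)) →
      ∃ α : ℂ, QuadrantBM.IsDecoupling S (QuadrantBM.ansatz S k n α) (QuadrantBM.Lh S k a n) ∧
        ((∀ j : ℕ, 1 ≤ j → j < n → (a j).im = 0) → α.im = 0)) ∧
    -- for every choice of decoupling functions of that form
    (∀ a : ℕ → ℂ,
      (∀ n : ℕ, 1 ≤ n →
        QuadrantBM.IsDecoupling S (QuadrantBM.ansatz S k n (a n)) (QuadrantBM.Lh S k a n)) →
      -- the singularities at the zeros of `γ` are removable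
      (∀ n : ℕ, 1 ≤ n → ∀ y : ℝ, 0 < y →
        DifferentiableOn ℂ (fun x : ℂ => QuadrantBM.Lh S k a n x y) Complex.slitPlane) ∧
      -- the functions are the Laplace transforms of a chain of polyharmonic functions
      (∃ h : ℕ → ℝ → ℝ → ℂ,
        (∀ u v : ℝ, h 0 u v = 0) ∧
        (∀ n : ℕ, 1 ≤ n →
          QuadrantBM.IsPolyharmonic S n (h n) ∧
          (∀ p ∈ QuadrantBM.quadrant,
            QuadrantBM.lap S (h n) p.1 p.2 = h (n - 1) p.1 p.2) ∧
          QuadrantBM.IsLaplaceTransform (h n) (QuadrantBM.Lh S k a n)) ∧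
        ((∀ n : ℕ, 1 ≤ n → (a n).im = 0) →
          ∀ (n : ℕ) (u v : ℝ), 0 ≤ u → 0 ≤ v → (h n u v).im = 0)) ∧
      -- their form
      (∀ n : ℕ, 1 ≤ n → ∃ q : ℂ → ℝ → ℂ,
        (∀ x ∈ Complex.slitPlane, ∀ y : ℝ, 0 < y →
          QuadrantBM.Lh S k a n x y =
            q x y / (x ^ (((k : ℝ) * QuadrantBM.beta S + 2 * (n : ℝ) : ℝ) : ℂ)
              * (y : ℂ) ^ (((k : ℝ) * QuadrantBM.beta S + 2 * (n : ℝ) : ℝ) : ℂ))) ∧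
        (∀ x ∈ Complex.slitPlane, ∀ y : ℝ, 0 < y → ∀ t : ℝ, 0 < t →
          q ((t : ℂ) * x) (t * y) =
            (t : ℂ) ^ (((k : ℝ) * QuadrantBM.beta S + 2 * (n : ℝ) : ℝ) : ℂ) * q x y) ∧
        (∃ P : MvPolynomial (Fin 4) ℂ, ∀ x ∈ Complex.slitPlane, ∀ y : ℝ, 0 < y →
          QuadrantBM.gam S x y ^ n * q x y =
            MvPolynomial.eval ![x, (y : ℂ), x ^ (QuadrantBM.beta S : ℂ),
              (y : ℂ) ^ (QuadrantBM.beta S : ℂ)] P) ∧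
        (∀ m : ℕ, (k : ℝ) * QuadrantBM.beta S = (m : ℝ) →
          ∃ Q : MvPolynomial (Fin 2) ℂ, Q.IsHomogeneous (m + 2 * n) ∧
            ∀ x ∈ Complex.slitPlane, ∀ y : ℝ, 0 < y →
              q x y = MvPolynomial.eval ![x, (y : ℂ)] Q))) := by
  classical
  refine ⟨fun a n hn hdec => ?_, fun a hdec => ⟨fun n _ => ?_, ?_, fun n hn => ?_⟩⟩
  · obtain ⟨n, rfl⟩ := Nat.exists_eq_add_of_le' hn
    -- With real constants the construction runs with K the real line, which makes the new constant
    -- real; otherwise the reality claim is vacuous and K = ℂ.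
    by_cases hreal : ∀ j : ℕ, 1 ≤ j → j < n + 1 → (a j).im = 0
    · obtain ⟨h, G, H, hL⟩ := QuadrantBM.exists_isWedgeSum (K := LinearMap.ker Complex.imLm) hS
        Complex.one_im hk n hreal hdec
      obtain ⟨α, hα, hd⟩ := QuadrantBM.exists_isDecoupling hS H hL
      exact ⟨α, hd, fun _ => hα⟩
    · obtain ⟨h, G, H, hL⟩ := QuadrantBM.exists_isWedgeSum (K := ⊤) hS trivial hk n
        (fun _ _ _ => trivial) hdec
      obtain ⟨α, -, hd⟩ := QuadrantBM.exists_isDecoupling hS H hL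
      exact ⟨α, hd, fun h => absurd h hreal⟩
  · exact (QuadrantBM.differentiableOn_Lh_and_map_smul hS hk hdec n).1
  · obtain ⟨K, hK1, haK, hKreal⟩ : ∃ K : Submodule ℝ ℂ, (1 : ℂ) ∈ K ∧ (∀ j, 1 ≤ j → a j ∈ K) ∧
        ((∀ n : ℕ, 1 ≤ n → (a n).im = 0) → ∀ z ∈ K, z.im = 0) := by
      by_cases hreal : ∀ n : ℕ, 1 ≤ n → (a n).im = 0
      · exact ⟨LinearMap.ker Complex.imLm, Complex.one_im, hreal, fun _ z hz => hz⟩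
      · exact ⟨⊤, trivial, fun _ _ => trivial, fun h => absurd h hreal⟩
    obtain ⟨c, hc0, hcs, hc⟩ := QuadrantBM.exists_chain hS hK1 hk haK hdec
    -- The chain is shifted by one to make room for h_0 = 0.
    let h : ℕ → ℝ → ℝ → ℂ := fun n => Nat.casesOn n (fun _ _ => 0) c
    have hlap : ∀ n, QuadrantBM.HasLap S (h (n + 1)) (h n) := fun n =>
      Nat.casesOn n hc0 hcs
    refine ⟨h, fun _ _ => rfl, fun n hn => ?_, fun hreal n u v _ _ => ?_⟩
    · obtain ⟨n, rfl⟩ := Nat.exists_eq_add_of_le' hn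
      obtain ⟨G, H, hL⟩ := hc n
      refine ⟨⟨H.contDiffOn hS, fun p hp => QuadrantBM.iterate_lap_eq_zero (fun _ _ => rfl) hlap
        (n + 1) p.1 p.2 hp.1 hp.2, H.continuousOn hS, fun v hv => H.zero_left hv,
        fun u hu => H.zero_right hS hu⟩, fun p hp => (hlap n).lap_eq hp.1 hp.2,
        fun x y hx hy => ?_⟩
      obtain ⟨h1, h2⟩ := H.isLaplaceTransform hS x y hx hy
      exact ⟨h1, (hL x (Or.inl hx) y hy).trans h2⟩
    · rcases n with _ | n
      · rfl
      · obtain ⟨G, H, -⟩ := hc n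
        exact hKreal hreal _ (H.apply_mem u v)
  · have hne : ∀ z : ℂ, z ≠ 0 → z ^ (((k : ℝ) * QuadrantBM.beta S + 2 * (n : ℝ) : ℝ) : ℂ) ≠ 0 :=
      fun z hz => by simp [Complex.cpow_eq_zero_iff, hz]
    -- Here q is L_n x^α y^α, so its degree is -α + 2α = α.
    refine ⟨fun x y => QuadrantBM.Lh S k a n x y
      * (x ^ (((k : ℝ) * QuadrantBM.beta S + 2 * (n : ℝ) : ℝ) : ℂ)
        * (y : ℂ) ^ (((k : ℝ) * QuadrantBM.beta S + 2 * (n : ℝ) : ℝ) : ℂ)),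
      fun x hx y hy => ?_, fun x hx y hy t ht => ?_,
      QuadrantBM.exists_mvPolynomial hS hk hdec n,
      fun m hm => QuadrantBM.exists_isHomogeneous hS hk hdec hm n⟩
    · exact (mul_div_cancel_right₀ _ (mul_ne_zero (hne x (Complex.slitPlane_ne_zero hx))
        (hne y (by exact_mod_cast hy.ne')))).symm
    · have ht0 := hne t (by exact_mod_cast ht.ne')
      beta_reduce
      rw [(QuadrantBM.differentiableOn_Lh_and_map_smul hS hk hdec n).2 x hx y hy t ht,
        Complex.cpow_neg, mul_comm (t : ℂ) x,
        QuadrantBM.cpow_mul_ofReal (Complex.slitPlane_ne_zero hx) ht, Complex.ofReal_mul,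
        Complex.mul_cpow_ofReal_nonneg ht.le hy.le]
      field_simp
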